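/- **Theorem.** In the $\mathsf{LOCAL}$ model the network is a simple undirected graph $G=(V,E)$ with $n$ nodes, not necessarily connected. The nodes have distinct identifiers that are non-negative integers at most $n^{c}$ for a constant $c$ (so $O(\log n)$ bits), and each node numbers its incident edges arbitrarily by ports. Initially a node knows $n$, its identifier and its degree. In each synchronous round every node sends a message of arbitrary size to each of its neighbors and performs arbitrary local computation. At the end every node outputs a label for each of its incident edges, and the two endpoints of an edge must give it consistent labels. The running time is the number of rounds. For every $c\in\mathbb{N}$ there is a constant $C>0$, depending only on $c$, such that for every real $\varepsilon>0$ there are deterministic $\mathsf{LOCAL}$ algorithms for (a) and (b) below which run, on every $n$-node graph, in at most $$C\cdot a\cdot\log a\cdot(\log\log a)^{1.71}\cdot\log n,\qquad a=\max\{\varepsilon^{-1},4\},$$ rounds; that is, in $O\big(\varepsilon^{-1}\cdot\log\varepsilon^{-1}\cdot(\log\log\varepsilon^{-1})^{1.71}\cdot\log n\big)$ rounds for $\varepsilon\le 1/4$, and in $O(\log n)$ rounds for $\varepsilon>1/4$. Here $\log$ is the natural logarithm, with the convention that the bound is $0$ if $n=0$. Write $d(v)$ for the degree of $v$. (a) Directed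 degree splitting: the algorithm orients every edge of $G$ such that at each node $v$ the absolute difference between the numbers of outgoing and incoming edges is at most $\varepsilon\, d(v)+1$ if $d(v)$ is odd, and at most $\varepsilon\, d(v)+2$ if $d(v)$ is even. (b) Undirected degree splitting: the algorithm colors every edge of $G$ red or blue such that at each node $v$ the absolute difference between the numbers of red and blue edges at $v$ is at most $\varepsilon\, d(v)+4$. -/

import Mathlib

universe u

/-- A deterministic algorithm in the `LOCAL` model whose nodes write one label of type `Out` on each
of their incident edges. A node initially knows the number `n` of nodes, its own identifier and its
degree `d`; its incident edges are told apart by the port numbers in `Fin d`. Messages, memory and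
local computation are unrestricted; the only cost is the number of communication rounds. -/
structure LocalAlgorithm (Out : Type) where
  /-- The possible local states of a node. -/
  State : Type
  /-- The possible messages. -/
  Msg : Type
  /-- `init n ident d` is the initial state. -/
  init : (n ident d : ℕ) → State
  /-- The message sent through each port in a round. -/
  send : (d : ℕ) → State → Fin d → Msg
  /-- The new state, computed from the old one and from the messages received at the ports. -/
  step : (d : ℕ) → State → (Fin d → Msg) → State
  /-- `rounds n` is the number of communication rounds executed on `n`-node graphs. -/
  rounds : (n : ℕ) → ℕ
  /-- The labels written on the incident edges at the end. -/
  output : (d : ℕ) → State → Fin d → Out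

/-- Turns the graph `G` into a network: the nodes get distinct identifiers, and every node numbers
its incident edges by ports. Both are arbitrary. -/
structure Network {V : Type*} [Fintype V] (G : SimpleGraph V) [DecidableRel G.Adj] where
  /-- The identifier of a node. -/
  ident : V → ℕ
  ident_injective : Function.Injective ident
  /-- The neighbor behind each port of a node. -/
  port : (v : V) → Fin (G.degree v) ≃ G.neighborSet v

namespace Network

variable {V : Type*} [Fintype V] {G : SimpleGraph V} [DecidableRel G.Adj]

/-- The port of `v` that leads to its neighbor `w`. -/
def portTo (N : Network G) {v w : V} (h : G.Adj v w) : Fin (G.degree v) :=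
  (N.port v).symm ⟨w, h⟩

end Network

namespace LocalAlgorithm

variable {Out : Type} {V : Type*} [Fintype V] {G : SimpleGraph V} [DecidableRel G.Adj]

/-- The state of each node after `t` synchronous rounds. In every round each node sends a message
through each of its ports, and the message received at port `i` of `v` is the one that the
neighbor behind port `i` sent through its port towards `v`. -/
def stateAfter (A : LocalAlgorithm Out) (N : Network G) : ℕ → V → A.State
  | 0, v => A.init (Fintype.card V) (N.ident v) (G.degree v)
  | t + 1, v =>
      A.step (G.degree v) (A.stateAfter N t v) fun i =>
        A.send (G.degree (N.port v i : V)) (A.stateAfter N t (N.port v i))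
          (N.portTo (SimpleGraph.Adj.symm (N.port v i).2))

/-- The label that node `v` writes on its edge to `w`. -/
def label (A : LocalAlgorithm Out) (N : Network G) {v w : V} (h : G.Adj v w) : Out :=
  A.output (G.degree v) (A.stateAfter N (A.rounds (Fintype.card V)) v) (N.portTo h)

end LocalAlgorithm

/-- `D` is an orientation of `G`: it contains exactly one of `(u, v)`, `(v, u)` for every edge
`{u, v}` of `G`, and nothing else. -/
def IsOrientation {V : Type*} (G : SimpleGraph V) (D : Digraph V) : Prop :=
  (∀ u v, D.Adj u v → G.Adj u v) ∧ ∀ u v, G.Adj u v → Xor (D.Adj u v) (D.Adj v u)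

/-- The difference between the numbers of outgoing and incoming edges of `v`. -/
noncomputable def directedDiscrepancy {V : Type*} (D : Digraph V) (v : V) : ℝ :=
  |({w | D.Adj v w}.ncard : ℝ) - ({w | D.Adj w v}.ncard : ℝ)|

/-- The difference between the numbers of edges at `v` colored `1` (red) and `-1` (blue). -/
noncomputable def undirectedDiscrepancy {V : Type*} [Fintype V] [DecidableEq V]
    (G : SimpleGraph V) [DecidableRel G.Adj] (q : Sym2 V → ℤˣ) (v : V) : ℝ :=
  |∑ e ∈ G.incidenceFinset v, ((q e : ℤ) : ℝ)|

/-- The two labels an endpoint can give to an edge in an orientation. -/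
inductive EdgeDirection : Type
  | outgoing
  | incoming

/-- The labels of all the nodes together describe the orientation `D`: `v` calls its edge to `w`
outgoing if `D` directs it from `v` to `w`, and incoming if `D` directs it from `w` to `v`. -/
def LocalAlgorithm.ComputesOrientation {V : Type*} [Fintype V] {G : SimpleGraph V}
    [DecidableRel G.Adj] (A : LocalAlgorithm EdgeDirection) (N : Network G) (D : Digraph V) :
    Prop :=
  ∀ (v w : V) (h : G.Adj v w),
    (A.label N h = EdgeDirection.outgoing ↔ D.Adj v w) ∧
    (A.label N h = EdgeDirection.incoming ↔ D.Adj w v)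

/-- Both endpoints of every edge `e` label it with its color `q e`. -/
def LocalAlgorithm.ComputesColoring {V : Type*} [Fintype V] {G : SimpleGraph V}
    [DecidableRel G.Adj] (A : LocalAlgorithm ℤˣ) (N : Network G) (q : Sym2 V → ℤˣ) : Prop :=
  ∀ (v w : V) (h : G.Adj v w), A.label N h = q s(v, w)

/-- `A` computes, on every graph whose identifiers are bounded by `n ^ c` (so have `O(log n)` bits),
an orientation with discrepancy at most `ε d(v) + 1` at nodes of odd degree and at most
`ε d(v) + 2` at nodes of even degree. -/
def LocalAlgorithm.SolvesDirectedSplitting (A : LocalAlgorithm EdgeDirection) (c : ℕ) (ε : ℝ) :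
    Prop :=
  ∀ (V : Type u) [Fintype V] (G : SimpleGraph V) [DecidableRel G.Adj] (N : Network G),
    (∀ v, N.ident v ≤ Fintype.card V ^ c) →
    ∃ D : Digraph V, IsOrientation G D ∧ A.ComputesOrientation N D ∧
      ∀ v : V,
        (Odd (G.degree v) → directedDiscrepancy D v ≤ ε * G.degree v + 1) ∧
        (Even (G.degree v) → directedDiscrepancy D v ≤ ε * G.degree v + 2)

/-- `A` computes, on every graph whose identifiers are bounded by `n ^ c` (so have `O(log n)` bits),
a red/blue coloring of the edges with discrepancy at most `ε d(v) + 4` at every node. -/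
def LocalAlgorithm.SolvesUndirectedSplitting (A : LocalAlgorithm ℤˣ) (c : ℕ) (ε : ℝ) : Prop :=
  ∀ (V : Type u) [Fintype V] [DecidableEq V] (G : SimpleGraph V) [DecidableRel G.Adj]
    (N : Network G),
    (∀ v, N.ident v ≤ Fintype.card V ^ c) →
    ∃ q : Sym2 V → ℤˣ, A.ComputesColoring N q ∧
      ∀ v : V, undirectedDiscrepancy G q v ≤ ε * G.degree v + 4

/-- The bound `a * log a * (log log a) ^ 1.71 * log n` with `a = ε⁻¹`; for `ε > 1 / 4`, where the
iterated logarithm may be negative or undefined, `a = 4` is used instead. -/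
noncomputable def splittingTime (ε : ℝ) (n : ℕ) : ℝ :=
  max ε⁻¹ 4 * Real.log (max ε⁻¹ 4) * Real.log (Real.log (max ε⁻¹ 4)) ^ (1.71 : ℝ) * Real.log n

/-
The half of an edge that lies at the node `v` and leads to `w` is the pair of the identifiers of
`v` and `w`. The half-edges at a node (in the undirected case, separately those leading to larger
and to smaller identifiers) are divided into groups of `2k`, where `k = ⌈1/ε⌉`, and one smaller
group, and each group is treated as a node of its own. It then suffices to orient the edges with
discrepancy at most `2` at every group, and at most `1` at groups of odd size: there are at most
`ε d / 2` full groups at a node of degree `d`.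

Pairing the half-edges at each group decomposes the edges into trails. If every edge were directed
along its trail, the discrepancies would be at most `1`, but trails may be long, and following them
is not a local operation. So they are cut. A ruling set, computed from the bits of the identifiers,
divides the trails locally into windows of length `4k`. As a group is visited by at most `2k`
half-edges, any set of windows meets at least twice as many groups as it has members. By expansion
and Hall's theorem, some windows within logarithmic distance of a given one, that one included, can
be matched to groups of their own in such a way that all other windows avoid these groups. Each
window is cut at its group; of the possible cut sets, the first one in a fixed enumeration wins.

At a group with one left-over half-edge, that half-edge and the two halves of the cut pair are
joined. Since windows are short, a trail now ends, closes or branches every `O(k)` steps. It cannot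
branch more than logarithmically often, for then it would reach more half-edges than there are. So
within distance `O(k log n)` of each edge, some edges including it can be oriented such that every
class of joined half-edges touched, unless it is a singleton, has both an outgoing and an incoming
member; again the first such orientation wins. Then at each group the uncut pairs cancel, and the
remaining half-edges, which are one joined class or at most two unjoined half-edges, contribute
what is allowed. All the choices depend only on the graph within distance `O(k log n)`, which every
node learns in as many rounds.
-/

namespace DegreeSplitting

section Involution

variable {α : Type*}

theorem even_card_of_involutive {m : α → α} (hm : Function.Involutive m) {F : Finset α}
    (hF : ∀ x ∈ F, m x ∈ F) (hne : ∀ x ∈ F, m x ≠ x) : Even F.card := by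
  have h : ∑ _x ∈ F, (1 : ZMod 2) = 0 :=
    Finset.sum_involution (fun x _ => m x) (fun _ _ => by decide) (fun x hx _ => hne x hx)
      hF (fun x _ => hm x)
  rw [Finset.sum_const, nsmul_eq_mul, mul_one] at h
  exact (ZMod.natCast_eq_zero_iff_even).1 h

theorem exists_ne_of_one_lt_card_of_imp {K : α → α → Prop} {F : Finset α} (hF : 1 < F.card) :
    ∃ a ∈ F, ∃ b ∈ F, a ≠ b ∧ ((∃ x ∈ F, ∃ y ∈ F, x ≠ y ∧ K x y) → K a b) := by
  by_cases h : ∃ x ∈ F, ∃ y ∈ F, x ≠ y ∧ K x y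
  · obtain ⟨x, hx, y, hy, hxy, hK⟩ := h
    exact ⟨x, hx, y, hy, hxy, fun _ => hK⟩
  · obtain ⟨x, hx, y, hy, hxy⟩ := Finset.one_lt_card.1 hF
    exact ⟨x, hx, y, hy, hxy, fun h' => absurd h' h⟩

/-- `m` pairs up the elements of `F`, with at most one of them left over, and fixes everything
else. -/
structure IsPairing (F : Set α) (m : α → α) : Prop where
  involutive : Function.Involutive m
  eq_self : ∀ x ∉ F, m x = x
  fixed_unique : ∀ x ∈ F, ∀ y ∈ F, m x = x → m y = y → x = y

theorem IsPairing.mem {F : Set α} {m : α → α} (hm : IsPairing F m) {x : α} (hx : x ∈ F) :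
    m x ∈ F := by
  by_contra h
  rw [hm.involutive.injective (hm.eq_self _ h)] at h
  exact h hx

theorem IsPairing.comp_swap [DecidableEq α] {F : Set α} {m : α → α} {a b : α} (hab : a ≠ b)
    (ha : a ∈ F) (hb : b ∈ F) (hm : IsPairing (F \ {a, b}) m) :
    IsPairing F (m ∘ Equiv.swap a b) := by
  have hma : m a = a := hm.eq_self a (by simp)
  have hmb : m b = b := hm.eq_self b (by simp)
  have hne : ∀ {x}, x ≠ a → x ≠ b → m x ≠ a ∧ m x ≠ b := fun h1 h2 =>
    ⟨fun h => h1 (hm.involutive.injective (h.trans hma.symm)),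
      fun h => h2 (hm.involutive.injective (h.trans hmb.symm))⟩
  have happ : ∀ x, (x = a ∧ (m ∘ Equiv.swap a b) x = b) ∨ (x = b ∧ (m ∘ Equiv.swap a b) x = a) ∨
      (x ≠ a ∧ x ≠ b ∧ (m ∘ Equiv.swap a b) x = m x) := by
    intro x
    rcases eq_or_ne x a with rfl | hxa
    · simp [hmb]
    rcases eq_or_ne x b with rfl | hxb
    · simp [hma]
    · simp [hxa, hxb, Equiv.swap_apply_of_ne_of_ne]
  have hfixed : ∀ {x}, (m ∘ Equiv.swap a b) x = x → x ≠ a ∧ x ≠ b ∧ m x = x := by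
    intro x hx
    rcases happ x with ⟨rfl, h⟩ | ⟨rfl, h⟩ | ⟨h1, h2, h⟩
    · exact absurd (hx.symm.trans h) hab
    · exact absurd (hx.symm.trans h) hab.symm
    · exact ⟨h1, h2, h.symm.trans hx⟩
  refine ⟨fun x => ?_, fun x hx => ?_, fun x hx y hy hfx hfy => ?_⟩
  · rcases happ x with ⟨rfl, h⟩ | ⟨rfl, h⟩ | ⟨h1, h2, h⟩
    · rw [h]; simp [hma]
    · rw [h]; simp [hmb]
    · obtain ⟨h3, h4⟩ := hne h1 h2
      rw [h]; simp [Equiv.swap_apply_of_ne_of_ne h3 h4, hm.involutive x]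
  · have hxa : x ≠ a := fun h => hx (h ▸ ha)
    have hxb : x ≠ b := fun h => hx (h ▸ hb)
    simpa [Equiv.swap_apply_of_ne_of_ne hxa hxb] using hm.eq_self x fun h => hx h.1
  · obtain ⟨hxa, hxb, hfx⟩ := hfixed hfx
    obtain ⟨hya, hyb, hfy⟩ := hfixed hfy
    exact hm.fixed_unique x ⟨hx, by simp [hxa, hxb]⟩ y ⟨hy, by simp [hya, hyb]⟩ hfx hfy

-- As long as two elements in the same class of `K` remain, such a pair is taken out.
theorem exists_isPairing_of_rel {K : α → α → Prop} (hsymm : ∀ ⦃x y⦄, K x y → K y x)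
    (htrans : ∀ ⦃x y z⦄, K x y → K y z → K x z) (F : Finset α) :
    ∃ m, IsPairing (F : Set α) m ∧
      ∀ x ∈ F, ∀ y ∈ F, x ≠ y → K x y → ∃ z ∈ F, K x z ∧ K x (m z) := by
  classical
  induction F using Finset.strongInduction with
  | H F ih =>
    rcases le_or_gt F.card 1 with hF | hF
    · have hunique := Finset.card_le_one.1 hF
      exact ⟨id, ⟨fun _ => rfl, fun _ _ => rfl, fun x hx y hy _ _ => hunique x hx y hy⟩,
        fun x hx y hy hxy => absurd (hunique x hx y hy) hxy⟩
    obtain ⟨a, ha, b, hb, hab, hK⟩ := exists_ne_of_one_lt_card_of_imp (K := K) hF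
    obtain ⟨m, hm, hmK⟩ := ih (F \ {a, b}) (Finset.sdiff_ssubset
      (by simp [Finset.insert_subset_iff, ha, hb]) ⟨a, by simp⟩)
    have hm' : IsPairing ((F : Set α) \ {a, b}) m := by simpa using hm
    refine ⟨m ∘ Equiv.swap a b, hm'.comp_swap hab ha hb, fun x hx y hy hxy hKxy => ?_⟩
    have hKab : K a b := hK ⟨x, hx, y, hy, hxy, hKxy⟩
    by_cases hxa : K x a
    · have hma : m b = b := hm'.eq_self b (by simp)
      exact ⟨a, ha, hxa, by simpa [hma] using htrans hxa hKab⟩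
    have hxb : ¬ K x b := fun h => hxa (htrans h (hsymm hKab))
    have hrest : ∀ z ∈ F, K x z → z ∈ F \ {a, b} := by
      intro z hz hxz
      have hza : z ≠ a := by rintro rfl; exact hxa hxz
      have hzb : z ≠ b := by rintro rfl; exact hxb hxz
      simp [hz, hza, hzb]
    have hxx : K x x := htrans hKxy (hsymm hKxy)
    obtain ⟨z, hz, hxz, hxmz⟩ := hmK x (hrest x hx hxx) y (hrest y hy hKxy) hxy hKxy
    simp only [Finset.mem_sdiff, Finset.mem_insert, Finset.mem_singleton, not_or] at hz
    have hswap := Equiv.swap_apply_of_ne_of_ne hz.2.1 hz.2.2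
    exact ⟨z, hz.1, hxz, by simpa [hswap] using hxmz⟩

theorem exists_isPairing {F : Set α} (hF : F.Finite) : ∃ m, IsPairing F m := by
  obtain ⟨F, rfl⟩ := hF.exists_finset_coe
  obtain ⟨m, hm, -⟩ := exists_isPairing_of_rel (K := fun _ _ : α => False)
    (fun _ _ => id) (fun _ _ _ h => h.elim) F
  exact ⟨m, hm⟩

theorem IsPairing.ne_of_even_card {F : Finset α} {m : α → α} (hm : IsPairing (F : Set α) m)
    (hF : Even F.card) {x : α} (hx : x ∈ F) : m x ≠ x := by
  classical
  intro hmx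
  have herase : Even (F.erase x).card := by
    refine even_card_of_involutive hm.involutive (fun y hy => ?_) fun y hy hmy => ?_
    · refine Finset.mem_erase.2 ⟨fun h => ?_, hm.mem (Finset.mem_of_mem_erase hy)⟩
      exact Finset.ne_of_mem_erase hy (hm.involutive.injective (h.trans hmx.symm))
    · exact Finset.ne_of_mem_erase hy
        (hm.fixed_unique y (Finset.mem_of_mem_erase hy) x hx hmy hmx)
  rw [Finset.card_erase_of_mem hx] at herase
  exact Nat.not_even_iff_odd.2 (Nat.Even.sub_odd (Finset.card_pos.2 ⟨x, hx⟩) hF odd_one) herase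

end Involution

section Alternating

variable {α : Type*}

open Equiv.Perm

theorem not_sameCycle_mul_of_involutive {a b : Equiv.Perm α} (ha : Function.Involutive a)
    (hb : Function.Involutive b) (ha' : ∀ x, a x ≠ x) (hb' : ∀ x, b x ≠ x) (x : α) :
    ¬ SameCycle (a * b) x (b x) := by
  have hreverse : ∀ (i : ℤ) x, ((a * b) ^ (-i)) (b x) = b (((a * b) ^ i) x) := by
    have hconj : b * (a * b) * b⁻¹ = (a * b)⁻¹ := by
      rw [mul_inv_rev, ← mul_assoc, mul_inv_cancel_right,
        inv_eq_of_mul_eq_one_left (Equiv.ext ha : a * a = 1),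
        inv_eq_of_mul_eq_one_left (Equiv.ext hb : b * b = 1)]
    intro i x
    rw [← inv_zpow', ← hconj, conj_zpow]
    simp only [Equiv.Perm.mul_apply, show b⁻¹ (b x) = x from b.symm_apply_apply x]
  rintro ⟨i, hi⟩
  rcases Int.even_or_odd' i with ⟨j, rfl | rfl⟩
  · refine hb' (((a * b) ^ j) x) ?_
    rw [← hreverse, ← hi, ← Equiv.Perm.mul_apply, ← zpow_add]
    congr 2
    ring
  · refine ha' (b (((a * b) ^ j) x)) ?_
    rw [← Equiv.Perm.mul_apply, ← Equiv.Perm.mul_apply, ← zpow_one_add, ← hreverse, ← hi,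
      ← Equiv.Perm.mul_apply, ← zpow_add]
    congr 2
    ring

-- The cycles of `a * b` are exchanged in pairs by `a` and by `b` alike; `P` picks one of each pair.
theorem exists_alternating {a b : Equiv.Perm α} (ha : Function.Involutive a)
    (hb : Function.Involutive b) (ha' : ∀ x, a x ≠ x) (hb' : ∀ x, b x ≠ x) :
    ∃ P : α → Prop, ∀ x, (P (a x) ↔ ¬ P x) ∧ (P (b x) ↔ ¬ P x) := by
  let q : α → Quotient (SameCycle.setoid (a * b)) := Quotient.mk _
  obtain ⟨_, -⟩ := exists_wellFoundedLT (Quotient (SameCycle.setoid (a * b)))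
  have hq : ∀ x, q (a (b x)) = q x := fun x => Quotient.sound (sameCycle_apply_left.2 (.refl _ x))
  have hne : ∀ x, q x ≠ q (b x) := fun x h =>
    not_sameCycle_mul_of_involutive ha hb ha' hb' x (Quotient.exact h)
  have hqa : ∀ x, q (a x) = q (b x) := fun x => by rw [← hq (b x), hb]
  have hqba : ∀ x, q (b (a x)) = q x := fun x => by rw [← hq (b (a x)), hb, ha]
  have hflip : ∀ x, q (b x) < q x ↔ ¬ q x < q (b x) := fun x =>
    ⟨fun h => h.asymm, fun h => (not_lt.1 h).lt_of_ne' (hne x)⟩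
  refine ⟨fun x => q x < q (b x), fun x => ⟨?_, ?_⟩⟩
  · change q (a x) < q (b (a x)) ↔ _
    rw [hqa, hqba, hflip]
  · change q (b x) < q (b (b x)) ↔ _
    rw [hb, hflip]

theorem exists_orientation {K : α → α → Prop} (hsymm : ∀ ⦃x y⦄, K x y → K y x)
    (htrans : ∀ ⦃x y z⦄, K x y → K y z → K x z) {σ : α → α} (hσ : Function.Involutive σ)
    {F : Finset α} (hσF : ∀ x ∈ F, σ x ∈ F) (hσne : ∀ x ∈ F, σ x ≠ x) :
    ∃ P : α → Prop, (∀ x ∈ F, P (σ x) ↔ ¬ P x) ∧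
      ∀ x ∈ F, ∀ y ∈ F, x ≠ y → K x y → (∃ a ∈ F, K x a ∧ P a) ∧ ∃ b ∈ F, K x b ∧ ¬ P b := by
  obtain ⟨m, hm, hmK⟩ := exists_isPairing_of_rel hsymm htrans F
  have hmne : ∀ x ∈ F, m x ≠ x := fun x =>
    hm.ne_of_even_card (even_card_of_involutive hσ hσF hσne)
  let a : Equiv.Perm F := (hm.involutive.toPerm m).subtypePerm (p := (· ∈ F)) fun x =>
    ⟨fun h => hm.involutive x ▸ hm.mem h, hm.mem⟩
  let b : Equiv.Perm F := (hσ.toPerm σ).subtypePerm (p := (· ∈ F)) fun x =>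
    ⟨fun h => hσ x ▸ hσF _ h, hσF x⟩
  obtain ⟨P, hP⟩ := exists_alternating (a := a) (b := b)
    (fun x => Subtype.ext (hm.involutive x)) (fun x => Subtype.ext (hσ x))
    (fun x h => hmne x x.2 (congrArg Subtype.val h))
    (fun x h => hσne x x.2 (congrArg Subtype.val h))
  have hval : ∀ x : F, (∃ h : (x : α) ∈ F, P ⟨x, h⟩) ↔ P x := fun x =>
    ⟨fun ⟨_, h⟩ => h, fun h => ⟨x.2, h⟩⟩
  refine ⟨fun x => ∃ h : x ∈ F, P ⟨x, h⟩, fun x hx => ?_, fun x hx y hy hxy hK => ?_⟩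
  · exact (hval (b ⟨x, hx⟩)).trans ((hP _).2.trans (not_congr (hval ⟨x, hx⟩).symm))
  · obtain ⟨z, hz, hxz, hxmz⟩ := hmK x hx y hy hxy hK
    have hflip : P (a ⟨z, hz⟩) ↔ ¬ P ⟨z, hz⟩ := (hP _).1
    have hmz := (a ⟨z, hz⟩).2
    by_cases hPz : P ⟨z, hz⟩
    · exact ⟨⟨z, hz, hxz, hz, hPz⟩, m z, hmz, hxmz, fun ⟨_, h⟩ => hflip.1 h hPz⟩
    · exact ⟨⟨m z, hmz, hxmz, hmz, hflip.2 hPz⟩, z, hz, hxz, fun ⟨_, h⟩ => hPz h⟩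

end Alternating

section ClosedMatching

variable {X Y : Type*} {N : X → Finset Y} {M B T : Finset X} {f : X → Y}

/-- A set of elements of `X` that `f` matches within the elements of `Y` offered, through `N`, only
to the set. -/
def IsClosedMatching (N : X → Finset Y) (T : Finset X) (f : X → Y) : Prop :=
  Set.InjOn f T ∧ ∀ x ∈ T, f x ∈ N x ∧ ∀ x', f x ∈ N x' → x' ∈ T

open Classical in
/-- The elements of `Y` offered to a member of `T` and to nothing outside of `M ∪ T`: those with
which a closed matching of `M` can be extended to `T`. -/
noncomputable def exclusive (N : X → Finset Y) (M T : Finset X) : Finset Y :=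
  {y ∈ T.biUnion N | ∀ x, y ∈ N x → x ∈ M ∪ T}

theorem mem_exclusive [DecidableEq X] {y : Y} :
    y ∈ exclusive N M T ↔ (∃ x ∈ T, y ∈ N x) ∧ ∀ x, y ∈ N x → x ∈ M ∪ T := by
  simp [exclusive]

theorem IsClosedMatching.union [DecidableEq X] (hM : IsClosedMatching N M f)
    (hTM : Disjoint T M) {g : X → Y} (hg : Set.InjOn g T)
    (hgN : ∀ x ∈ T, g x ∈ N x ∧ g x ∈ exclusive N M T) :
    IsClosedMatching N (M ∪ T) (T.piecewise g f) := by
  have hFT : ∀ x ∈ T, T.piecewise g f x = g x := fun x => T.piecewise_eq_of_mem g f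
  have hFM : ∀ x ∈ M, T.piecewise g f x = f x := fun x hx =>
    T.piecewise_eq_of_notMem g f (Finset.disjoint_right.1 hTM hx)
  have hcross : ∀ x ∈ M, ∀ z ∈ T, f x ≠ g z := fun x hx z hz h =>
    Finset.disjoint_left.1 hTM hz ((hM.2 x hx).2 z (h ▸ (hgN z hz).1))
  refine ⟨fun x hx z hz hxz => ?_, fun x hx => ?_⟩
  · rcases Finset.mem_union.1 hx with hx | hx <;> rcases Finset.mem_union.1 hz with hz | hz
    · exact hM.1 hx hz (by rwa [hFM x hx, hFM z hz] at hxz)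
    · exact absurd (by rwa [hFM x hx, hFT z hz] at hxz) (hcross x hx z hz)
    · exact absurd (by rwa [hFT x hx, hFM z hz, eq_comm] at hxz) (hcross z hz x hx)
    · exact hg hx hz (by rwa [hFT x hx, hFT z hz] at hxz)
  · rcases Finset.mem_union.1 hx with hx | hx
    · rw [hFM x hx]
      exact ⟨(hM.2 x hx).1, fun z hz => Finset.mem_union_left _ ((hM.2 x hx).2 z hz)⟩
    · rw [hFT x hx]
      exact ⟨(hgN x hx).1, (mem_exclusive.1 (hgN x hx).2).2⟩

theorem exclusive_subset_union [DecidableEq X] [DecidableEq Y] (s : Finset X) :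
    exclusive N M T ⊆
      (s.biUnion fun x => N x ∩ exclusive N M T) ∪ exclusive N M (T \ s) := by
  intro y hy
  obtain ⟨⟨x, hx, hxy⟩, hyN⟩ := mem_exclusive.1 hy
  by_cases hys : ∃ z ∈ s, y ∈ N z
  · obtain ⟨z, hz, hzy⟩ := hys
    exact Finset.mem_union_left _ (Finset.mem_biUnion.2 ⟨z, hz, Finset.mem_inter.2 ⟨hzy, hy⟩⟩)
  · push Not at hys
    have hnot : ∀ z, y ∈ N z → z ∉ s := fun z hz hzs => hys z hzs hz
    refine Finset.mem_union_right _ (mem_exclusive.2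
      ⟨⟨x, Finset.mem_sdiff.2 ⟨hx, hnot x hxy⟩, hxy⟩, fun z hz => ?_⟩)
    have := hyN z hz
    simp only [Finset.mem_union, Finset.mem_sdiff] at this ⊢
    exact this.imp_right fun h => ⟨h, hnot z hz⟩

theorem exists_injOn_exclusive [Nonempty Y] (hlt : ∀ T' ⊂ T, (exclusive N M T').card ≤ T'.card)
    (hT : T.card ≤ (exclusive N M T).card) :
    ∃ g : X → Y, Set.InjOn g T ∧ ∀ x ∈ T, g x ∈ N x ∧ g x ∈ exclusive N M T := by
  classical
  have hall : ∀ s ⊆ T, s.card ≤ (s.biUnion fun x => N x ∩ exclusive N M T).card := by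
    intro s hs
    rcases s.eq_empty_or_nonempty with rfl | hne
    · simp
    have h1 := (Finset.card_le_card (exclusive_subset_union (N := N) (M := M) (T := T) s)).trans
      (Finset.card_union_le _ _)
    have h2 := hlt (T \ s) (Finset.sdiff_ssubset hs hne)
    have h3 := Finset.card_sdiff_add_card_eq_card hs
    omega
  obtain ⟨g, hg, hgN⟩ := (Finset.all_card_le_biUnion_card_iff_exists_injective
    fun x : T => N x ∩ exclusive N M T).1 fun s => by
      have hs := hall (s.image Subtype.val) (by simp [Finset.image_subset_iff])
      rwa [Finset.card_image_of_injective _ Subtype.val_injective, Finset.image_biUnion] at hs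
  refine ⟨fun x => if h : x ∈ T then g ⟨x, h⟩ else Classical.arbitrary Y,
    fun x hx z hz hxz => ?_, fun x hx => ?_⟩
  · simp only [dif_pos (Finset.mem_coe.1 hx), dif_pos (Finset.mem_coe.1 hz)] at hxz
    exact congrArg Subtype.val (hg hxz)
  · simpa only [dif_pos hx, Finset.mem_inter] using hgN ⟨x, hx⟩

/-- `M` is a largest set in `B` that has a closed matching. -/
def IsMaximalClosed (N : X → Finset Y) (B M : Finset X) : Prop :=
  Maximal (fun M => M ⊆ B ∧ ∃ f, IsClosedMatching N M f) M

-- A minimal counterexample could be added to `M`, by Hall's theorem.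
theorem IsMaximalClosed.card_exclusive_lt (hM : IsMaximalClosed N B M) (hT : T.Nonempty)
    (hTB : T ⊆ B) (hTM : Disjoint T M) : (exclusive N M T).card < T.card := by
  classical
  induction T using Finset.strongInduction with
  | H T ih =>
    by_contra! hle
    have hlt : ∀ T' ⊂ T, (exclusive N M T').card ≤ T'.card := by
      intro T' hT'
      rcases T'.eq_empty_or_nonempty with rfl | hne
      · simp [exclusive]
      · exact (ih T' hT' hne (hT'.1.trans hTB) (Finset.disjoint_of_subset_left hT'.1 hTM)).le
    obtain ⟨⟨hMB, f, hf⟩, hmax⟩ := hM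
    obtain ⟨x, hx⟩ := hT
    have : Nonempty Y := ⟨f x⟩
    obtain ⟨g, hg, hgN⟩ := exists_injOn_exclusive hlt hle
    have hTM' : M ∪ T ⊆ M := hmax ⟨Finset.union_subset hMB hTB, _, hf.union hTM hg hgN⟩
      Finset.subset_union_left
    exact Finset.disjoint_left.1 hTM hx (hTM' (Finset.mem_union_right M hx))

variable [DecidableEq Y] {ball : ℕ → Finset X} {x₀ : X} {m : ℕ}

theorem IsMaximalClosed.two_pow_le_card_sdiff [DecidableEq X]
    (hM : IsMaximalClosed N (ball m) M)
    (hratio : ∀ A : Finset X, 2 * A.card ≤ (A.biUnion N).card) (hmono : Monotone ball)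
    (hstep : ∀ t, ∀ x ∈ ball t, ∀ y ∈ N x, ∀ x', y ∈ N x' → x' ∈ ball (t + 1))
    (h0 : x₀ ∈ ball 0) (hx₀ : x₀ ∉ M) {t : ℕ} (ht : t ≤ m) : 2 ^ t ≤ (ball t \ M).card := by
  induction t with
  | zero => exact Finset.card_pos.2 ⟨x₀, Finset.mem_sdiff.2 ⟨h0, hx₀⟩⟩
  | succ t ih =>
    have hlt := hM.card_exclusive_lt
      ⟨x₀, Finset.mem_sdiff.2 ⟨hmono (Nat.zero_le (t + 1)) h0, hx₀⟩⟩
      (Finset.sdiff_subset.trans (hmono ht)) Finset.sdiff_disjoint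
    have hsub : (ball t \ M).biUnion N ⊆ exclusive N M (ball (t + 1) \ M) := by
      intro y hy
      obtain ⟨x, hx, hxy⟩ := Finset.mem_biUnion.1 hy
      obtain ⟨hxb, hxM⟩ := Finset.mem_sdiff.1 hx
      refine mem_exclusive.2
        ⟨⟨x, Finset.mem_sdiff.2 ⟨hmono t.le_succ hxb, hxM⟩, hxy⟩, fun z hz => ?_⟩
      rw [Finset.union_sdiff_self_eq_union]
      exact Finset.mem_union_right _ (hstep t x hxb y hxy z hz)
    have h1 := ih (Nat.le_of_succ_le ht)
    have h2 := hratio (ball t \ M)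
    have h3 := Finset.card_le_card hsub
    rw [pow_succ]
    omega

-- Otherwise the balls, less a maximal closed set, double in size with every step.
theorem exists_isClosedMatching (hratio : ∀ A : Finset X, 2 * A.card ≤ (A.biUnion N).card)
    (hmono : Monotone ball)
    (hstep : ∀ t, ∀ x ∈ ball t, ∀ y ∈ N x, ∀ x', y ∈ N x' → x' ∈ ball (t + 1))
    (h0 : x₀ ∈ ball 0) (hm : (ball m).card < 2 ^ m) :
    ∃ S f, S ⊆ ball m ∧ x₀ ∈ S ∧ IsClosedMatching N S f := by
  classical
  obtain ⟨y₀, -⟩ : (N x₀).Nonempty := by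
    have := hratio {x₀}
    rw [Finset.singleton_biUnion, Finset.card_singleton] at this
    exact Finset.card_pos.1 (by omega)
  obtain ⟨M, hM⟩ := Set.Finite.exists_maximal
    (s := {M | M ⊆ ball m ∧ ∃ f, IsClosedMatching N M f})
    ((ball m).powerset.finite_toSet.subset fun M hM => Finset.mem_powerset.2 hM.1)
    ⟨∅, by simp, fun _ => y₀, by simp [IsClosedMatching]⟩
  have hM' : IsMaximalClosed N (ball m) M := hM
  obtain ⟨⟨hMB, f, hf⟩, -⟩ := hM
  refine ⟨M, f, hMB, ?_, hf⟩
  by_contra hx₀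
  have hgrowth := hM'.two_pow_le_card_sdiff hratio hmono hstep h0 hx₀ le_rfl
  have := Finset.card_le_card (Finset.sdiff_subset (s := ball m) (t := M))
  omega

end ClosedMatching

section HalfEdge

/-- The half of the edge between the nodes with identifiers `h.1` and `h.2` that lies at `h.1`. -/
abbrev HalfEdge := ℕ × ℕ

/-- The relation of two half-edges to be incident to the same node. -/
abbrev Incidence := HalfEdge → HalfEdge → Prop

variable {E E' : Incidence} {r s t : ℕ} {h g f : HalfEdge}

/-- The node at which `h` lies, given as the set of its half-edges. -/
def node (E : Incidence) (h : HalfEdge) : Set HalfEdge := {g | E h g}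

theorem rel_of_node_eq (hv : E g g) (H : node E h = node E g) : E h g :=
  (Set.ext_iff.1 H g).2 hv

/-- `g` is reached from `h` by at most `r` steps, each of which moves to the other half of the
current edge or to another half-edge at the current node. -/
def Near (E : Incidence) : ℕ → HalfEdge → HalfEdge → Prop
  | 0, h, g => g = h
  | r + 1, h, g => ∃ f, Near E r h f ∧ (g = f ∨ g = f.swap ∨ E f g)

theorem Near.refl (E : Incidence) (h : HalfEdge) : Near E 0 h h := rfl

theorem Near.succ (H : Near E r h g) : Near E (r + 1) h g := ⟨g, H, Or.inl rfl⟩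

theorem Near.swap (H : Near E r h g) : Near E (r + 1) h g.swap := ⟨g, H, Or.inr (Or.inl rfl)⟩

theorem Near.rel (H : Near E r h g) (hf : E g f) : Near E (r + 1) h f :=
  ⟨g, H, Or.inr (Or.inr hf)⟩

theorem Near.mono (H : Near E r h g) (hs : r ≤ s) : Near E s h g := by
  induction hs with
  | refl => exact H
  | step _ ih => exact ih.succ

theorem Near.trans (H : Near E r h f) (H' : Near E s f g) : Near E (r + s) h g := by
  induction s generalizing g with
  | zero => cases H'; exact H
  | succ s ih =>
    obtain ⟨f', hf', hg⟩ := H'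
    exact ⟨f', ih hf', hg⟩

theorem near_self (E : Incidence) (r : ℕ) (h : HalfEdge) : Near E r h h :=
  (Near.refl E h).mono (Nat.zero_le r)

theorem near_one_swap (E : Incidence) (h : HalfEdge) : Near E 1 h h.swap := (Near.refl E h).swap

theorem near_one_of_rel (H : E h g) : Near E 1 h g := (Near.refl E h).rel H

/-- `E` and `E'` agree on the ball of radius `r` around `h`. -/
def Agree (E E' : Incidence) (r : ℕ) (h : HalfEdge) : Prop :=
  ∀ g, Near E r h g → ∀ f, E g f ↔ E' g f

theorem Agree.rel_iff (A : Agree E E' r h) (f : HalfEdge) : E h f ↔ E' h f :=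
  A h (near_self E r h) f

theorem Agree.of_near (A : Agree E E' r h) (hg : Near E s h g) (hs : s + t ≤ r) : Agree E E' t g :=
  fun f hf => A f ((hg.trans hf).mono hs)

theorem Agree.mono (A : Agree E E' r h) (hs : s ≤ r) : Agree E E' s h :=
  A.of_near (Near.refl E h) (by omega)

theorem Agree.node_eq (A : Agree E E' r h) : node E h = node E' h := Set.ext A.rel_iff

theorem Agree.near_iff (A : Agree E E' r h) (g : HalfEdge) : Near E r h g ↔ Near E' r h g := by
  induction r generalizing g with
  | zero => exact Iff.rfl
  | succ r ih =>
    have A' : Agree E E' r h := A.mono (Nat.le_succ r)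
    constructor
    · rintro ⟨f, hf, H⟩
      exact ⟨f, (ih A' f).1 hf, by rwa [← A f hf.succ]⟩
    · rintro ⟨f, hf, H⟩
      have hf' := (ih A' f).2 hf
      exact ⟨f, hf', by rwa [A f hf'.succ]⟩

/-- `E` describes the half-edges of a graph with nodes of finite degree. Only those `h` with
`E h h` are half-edges of the graph. -/
structure IsIncidence (E : Incidence) : Prop where
  symm : ∀ {h g}, E h g → E g h
  trans : ∀ {h g f}, E h g → E g f → E h f
  swap : ∀ {h}, E h h → E h.swap h.swap
  swap_ne : ∀ {h}, E h h → h.swap ≠ h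
  finite : ∀ h, (node E h).Finite

namespace IsIncidence

theorem left (hE : IsIncidence E) (H : E h g) : E h h := hE.trans H (hE.symm H)

theorem right (hE : IsIncidence E) (H : E h g) : E g g := hE.left (hE.symm H)

theorem near_symm (hE : IsIncidence E) (H : Near E r h g) : Near E r g h := by
  induction r generalizing g with
  | zero => exact Eq.symm H
  | succ r ih =>
    obtain ⟨f, hf, hfg⟩ := H
    have hgf : Near E 1 g f := by
      rcases hfg with rfl | rfl | hfg
      · exact near_self E 1 _
      · simpa using near_one_swap E f.swap
      · exact near_one_of_rel (hE.symm hfg)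
    rw [Nat.add_comm]
    exact hgf.trans (ih hf)

theorem near_valid (hE : IsIncidence E) (hv : E h h) (H : Near E r h g) : E g g := by
  induction r generalizing g with
  | zero => cases H; exact hv
  | succ r ih =>
    obtain ⟨f, hf, rfl | rfl | H⟩ := H
    · exact ih hf
    · exact hE.swap (ih hf)
    · exact hE.right H

theorem node_eq (hE : IsIncidence E) (H : E h g) : node E h = node E g :=
  Set.ext fun _ => ⟨hE.trans (hE.symm H), hE.trans H⟩

end IsIncidence

end HalfEdge

section Trail

variable {E E' : Incidence} {i j r L : ℕ} {h g : HalfEdge}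

open Classical in
/-- A chosen pairing of the finite set `C`. -/
noncomputable def pairing (C : Set HalfEdge) : HalfEdge → HalfEdge :=
  if hC : C.Finite then (exists_isPairing hC).choose else id

theorem isPairing_pairing {C : Set HalfEdge} (hC : C.Finite) : IsPairing C (pairing C) := by
  rw [pairing, dif_pos hC]
  exact (exists_isPairing hC).choose_spec

theorem pairing_eq_self_or_mem (C : Set HalfEdge) (h : HalfEdge) :
    pairing C h = h ∨ pairing C h ∈ C := by
  by_cases hC : C.Finite
  · by_cases hh : h ∈ C
    · exact Or.inr ((isPairing_pairing hC).mem hh)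
    · exact Or.inl ((isPairing_pairing hC).eq_self h hh)
  · rw [pairing, dif_neg hC]
    exact Or.inl rfl

/-- The half-edge paired with `h` at its node; `h` itself if it is the one that is left over. -/
noncomputable def mate (E : Incidence) (h : HalfEdge) : HalfEdge := pairing (node E h) h

/-- The half-edge on which a trail that leaves through `h` goes on. -/
noncomputable def fwd (E : Incidence) (h : HalfEdge) : HalfEdge := mate E h.swap

/-- The half-edge from which a trail arrives that goes on with `h`. -/
noncomputable def bwd (E : Incidence) (h : HalfEdge) : HalfEdge := (mate E h).swap

theorem near_mate (E : Incidence) (h : HalfEdge) : Near E 1 h (mate E h) := by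
  rcases pairing_eq_self_or_mem (node E h) h with H | H
  · rw [mate, H]
    exact near_self E 1 h
  · exact near_one_of_rel H

theorem near_fwd (E : Incidence) (h : HalfEdge) : Near E 2 h (fwd E h) :=
  (near_one_swap E h).trans (near_mate E h.swap)

theorem near_bwd (E : Incidence) (h : HalfEdge) : Near E 2 h (bwd E h) :=
  (near_mate E h).swap

theorem near_iterate_of_near_two {φ : HalfEdge → HalfEdge} (hφ : ∀ h, Near E 2 h (φ h)) (j : ℕ)
    (h : HalfEdge) : Near E (2 * j) h (φ^[j] h) := by
  induction j with
  | zero => rfl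
  | succ j ih =>
    rw [Function.iterate_succ_apply']
    exact ih.trans (hφ _)

theorem near_iterate_fwd (E : Incidence) (j : ℕ) (h : HalfEdge) :
    Near E (2 * j) h ((fwd E)^[j] h) :=
  near_iterate_of_near_two (near_fwd E) j h

theorem near_iterate_bwd (E : Incidence) (j : ℕ) (h : HalfEdge) :
    Near E (2 * j) h ((bwd E)^[j] h) :=
  near_iterate_of_near_two (near_bwd E) j h

theorem Agree.mate_eq (A : Agree E E' r h) : mate E h = mate E' h := by
  rw [mate, A.node_eq, mate]

theorem Agree.iterate_fwd_eq (A : Agree E E' r h) (hr : 2 * j ≤ r) :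
    (fwd E)^[j] h = (fwd E')^[j] h := by
  induction j with
  | zero => rfl
  | succ j ih =>
    rw [Function.iterate_succ_apply', Function.iterate_succ_apply', ← ih (by omega)]
    exact Agree.mate_eq (r := 0) (A.of_near (near_iterate_fwd E j h).swap (by omega))

theorem Agree.iterate_bwd_eq (A : Agree E E' r h) (hr : 2 * j ≤ r) :
    (bwd E)^[j] h = (bwd E')^[j] h := by
  induction j with
  | zero => rfl
  | succ j ih =>
    rw [Function.iterate_succ_apply', Function.iterate_succ_apply', ← ih (by omega)]
    exact congrArg Prod.swap
      (Agree.mate_eq (r := 0) (A.of_near (near_iterate_bwd E j h) (by omega)))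

namespace IsIncidence

theorem mate_rel (hE : IsIncidence E) (hv : E h h) : E h (mate E h) :=
  (isPairing_pairing (hE.finite h)).mem hv

theorem mate_involutive (hE : IsIncidence E) : Function.Involutive (mate E) := by
  intro h
  have hpair := isPairing_pairing (hE.finite h)
  by_cases hv : E h h
  · rw [mate, ← hE.node_eq (hE.mate_rel hv)]
    exact hpair.involutive h
  · have hfix : mate E h = h := hpair.eq_self h hv
    rw [hfix, hfix]

theorem eq_of_mate_eq_self (hE : IsIncidence E) (H : E h g) (hh : mate E h = h)
    (hg : mate E g = g) : h = g := by
  rw [mate, ← hE.node_eq H] at hg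
  exact (isPairing_pairing (hE.finite h)).fixed_unique h (hE.left H) g H hh hg

theorem bwd_fwd (hE : IsIncidence E) : Function.LeftInverse (bwd E) (fwd E) := fun h => by
  rw [bwd, fwd, hE.mate_involutive, Prod.swap_swap]

theorem fwd_bwd (hE : IsIncidence E) : Function.LeftInverse (fwd E) (bwd E) := fun h => by
  rw [bwd, fwd, Prod.swap_swap, hE.mate_involutive]

theorem iterate_fwd_valid (hE : IsIncidence E) (hv : E h h) (j : ℕ) :
    E ((fwd E)^[j] h) ((fwd E)^[j] h) :=
  hE.near_valid hv (near_iterate_fwd E j h)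

theorem iterate_fwd_iterate_bwd (hE : IsIncidence E) (hij : i ≤ j) (h : HalfEdge) :
    (fwd E)^[i] ((bwd E)^[j] h) = (bwd E)^[j - i] h := by
  obtain ⟨d, rfl⟩ := Nat.exists_eq_add_of_le hij
  rw [Function.iterate_add_apply, hE.fwd_bwd.iterate i, Nat.add_sub_cancel_left]

end IsIncidence

/-- `g` is one of the `L` half-edges before or after `h` on its trail, or `h` itself. -/
def OnTrail (E : Incidence) (L : ℕ) (h g : HalfEdge) : Prop :=
  ∃ j ≤ L, g = (fwd E)^[j] h ∨ g = (bwd E)^[j] h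

theorem OnTrail.symm (hE : IsIncidence E) (H : OnTrail E L h g) : OnTrail E L g h := by
  obtain ⟨j, hj, rfl | rfl⟩ := H
  · exact ⟨j, hj, Or.inr (hE.bwd_fwd.iterate j h).symm⟩
  · exact ⟨j, hj, Or.inl (hE.fwd_bwd.iterate j h).symm⟩

theorem OnTrail.near (H : OnTrail E L h g) : Near E (2 * L) h g := by
  obtain ⟨j, hj, rfl | rfl⟩ := H
  · exact (near_iterate_fwd E j h).mono (by omega)
  · exact (near_iterate_bwd E j h).mono (by omega)

theorem Agree.onTrail_iff (A : Agree E E' r h) (hr : 2 * L ≤ r) :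
    OnTrail E L h g ↔ OnTrail E' L h g :=
  exists_congr fun j => and_congr_right fun hj => by
    rw [A.iterate_fwd_eq (j := j) (by omega), A.iterate_bwd_eq (j := j) (by omega)]

end Trail

section Ruling

variable {E E' : Incidence} {i j r t L β : ℕ} {h g : HalfEdge}

/-- The number by which a half-edge is identified. -/
def code (h : HalfEdge) : ℕ := Nat.pair h.1 h.2

theorem code_injective : Function.Injective code := fun _ _ H =>
  Prod.ext (Nat.pair_eq_pair.1 H).1 (Nat.pair_eq_pair.1 H).2

/-- The half-edges that are left after `i` steps of a ruling set algorithm on the trails: in step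
`i`, a half-edge whose code has bit `i` is deleted if one without this bit is at distance at most
`L` on its trail. -/
def Ruling (E : Incidence) (L : ℕ) : ℕ → HalfEdge → Prop
  | 0, _ => True
  | i + 1, h => Ruling E L i h ∧ ((code h).testBit i = true →
      ∀ g, OnTrail E L h g → Ruling E L i g → (code g).testBit i = true)

theorem Ruling.mono (H : Ruling E L j h) (hij : i ≤ j) : Ruling E L i h := by
  induction hij with
  | refl => exact H
  | step _ ih => exact ih H.1

theorem Ruling.eq_of_onTrail (hE : IsIncidence E) (hg : Ruling E L β g) (hh : Ruling E L β h)
    (hgβ : code g < 2 ^ β) (hhβ : code h < 2 ^ β) (H : OnTrail E L h g) : g = h := by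
  by_contra hne
  obtain ⟨i, hi⟩ := Nat.exists_testBit_ne_of_ne (code_injective.ne hne)
  have hiβ : i < β := by
    by_contra! hle
    have hpow : 2 ^ β ≤ 2 ^ i := Nat.pow_le_pow_right (by norm_num) hle
    rw [Nat.testBit_lt_two_pow (hhβ.trans_le hpow),
      Nat.testBit_lt_two_pow (hgβ.trans_le hpow)] at hi
    exact hi rfl
  have hg' := hg.mono (Nat.succ_le_of_lt hiβ)
  have hh' := hh.mono (Nat.succ_le_of_lt hiβ)
  cases hbit : (code h).testBit i with
  | true => exact hi ((hh'.2 hbit g H hg'.1).trans hbit.symm)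
  | false =>
    rw [hbit, Bool.ne_false_iff] at hi
    exact absurd (hg'.2 hi h (H.symm hE) hh'.1) (by simp [hbit])

theorem exists_ruling_iterate_bwd (hE : IsIncidence E) (L i : ℕ) (h : HalfEdge) :
    ∃ j ≤ 2 * L * i, Ruling E L i ((bwd E)^[j] h) := by
  induction i generalizing h with
  | zero => exact ⟨0, by simp, trivial⟩
  | succ i ih =>
    obtain ⟨j, hj, hr⟩ := ih ((bwd E)^[L] h)
    rw [← Function.iterate_add_apply] at hr
    rw [Nat.mul_succ]
    by_cases hr' : Ruling E L (i + 1) ((bwd E)^[j + L] h)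
    · exact ⟨j + L, by omega, hr'⟩
    rw [Ruling, not_and] at hr'
    have hdel := hr' hr
    push Not at hdel
    obtain ⟨-, g, ⟨j', hj', hg⟩, hgr, hgbit⟩ := hdel
    have hgr' : Ruling E L (i + 1) g := ⟨hgr, fun h => absurd h hgbit⟩
    rcases hg with rfl | rfl
    · rw [hE.iterate_fwd_iterate_bwd (by omega)] at hgr'
      exact ⟨j + L - j', by omega, hgr'⟩
    · rw [← Function.iterate_add_apply] at hgr'
      exact ⟨j' + (j + L), by omega, hgr'⟩

theorem Agree.ruling_iff (A : Agree E E' r h) (hr : 2 * (L * i) ≤ r) :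
    Ruling E L i h ↔ Ruling E' L i h := by
  induction i generalizing h r with
  | zero => exact Iff.rfl
  | succ i ih =>
    rw [Nat.mul_succ] at hr
    rw [Ruling, Ruling, ih A (by omega)]
    refine and_congr_right' (imp_congr_right fun _ => forall_congr' fun g => ?_)
    rw [← A.onTrail_iff (by omega)]
    exact imp_congr_right fun hg => imp_congr_left
      (ih (r := 2 * (L * i)) (A.of_near hg.near (by omega)) le_rfl)

/-- The distance to the last half-edge of the ruling set on the trail. -/
noncomputable def lag (E : Incidence) (L β : ℕ) (h : HalfEdge) : ℕ :=
  sInf {t | t ≤ 2 * L * β ∧ Ruling E L β ((bwd E)^[t] h)}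

theorem lag_spec (hE : IsIncidence E) (L β : ℕ) (h : HalfEdge) :
    lag E L β h ≤ 2 * L * β ∧ Ruling E L β ((bwd E)^[lag E L β h] h) :=
  Nat.sInf_mem (s := {t | t ≤ 2 * L * β ∧ Ruling E L β ((bwd E)^[t] h)})
    (exists_ruling_iterate_bwd hE L β h)

theorem lag_le (ht : t ≤ 2 * L * β) (hr : Ruling E L β ((bwd E)^[t] h)) : lag E L β h ≤ t :=
  Nat.sInf_le ⟨ht, hr⟩

theorem lag_eq_zero (hr : Ruling E L β h) : lag E L β h = 0 :=
  Nat.le_zero.1 (lag_le (Nat.zero_le _) hr)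

theorem lag_fwd (hE : IsIncidence E) (hr : ¬ Ruling E L β (fwd E h)) :
    lag E L β (fwd E h) = lag E L β h + 1 := by
  obtain ⟨hle, hlag⟩ := lag_spec hE L β h
  obtain ⟨hle', hlag'⟩ := lag_spec hE L β (fwd E h)
  cases ht : lag E L β (fwd E h) with
  | zero => rw [ht] at hlag'; exact absurd hlag' hr
  | succ s =>
    rw [ht, Function.iterate_succ_apply, hE.bwd_fwd] at hlag'
    have hs : lag E L β h ≤ s := lag_le (by omega) hlag'
    have hs' : lag E L β (fwd E h) ≤ lag E L β h + 1 := lag_le (by omega) (by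
      rwa [Function.iterate_succ_apply, hE.bwd_fwd])
    omega

theorem lag_iterate_fwd (hE : IsIncidence E)
    (hr : ∀ i, 1 ≤ i → i ≤ j → ¬ Ruling E L β ((fwd E)^[i] h)) :
    lag E L β ((fwd E)^[j] h) = lag E L β h + j := by
  induction j with
  | zero => rfl
  | succ j ih =>
    have hj := hr (j + 1) (by omega) le_rfl
    rw [Function.iterate_succ_apply'] at hj ⊢
    rw [lag_fwd hE hj, ih fun i hi hij => hr i hi (by omega), Nat.add_assoc]

theorem Agree.lag_eq (A : Agree E E' r h) (hr : 6 * (L * β) ≤ r) :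
    lag E L β h = lag E' L β h := by
  refine congrArg sInf (Set.ext fun t => and_congr_right fun ht => ?_)
  rw [Nat.mul_assoc] at ht
  rw [← A.iterate_bwd_eq (j := t) (by omega)]
  exact Agree.ruling_iff (r := 2 * (L * β)) (A.of_near (near_iterate_bwd E t h) (by omega)) le_rfl

end Ruling

section Window

variable {E E' : Incidence} {i j r L β : ℕ} {h g f : HalfEdge}

/-- The `L` consecutive half-edges of a trail that start with `h`. -/
noncomputable def window (E : Incidence) (L : ℕ) (h : HalfEdge) : Finset HalfEdge :=
  (Finset.range L).image fun i => (fwd E)^[i] h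

theorem mem_window : f ∈ window E L h ↔ ∃ i < L, (fwd E)^[i] h = f := by simp [window]

theorem near_of_mem_window (hf : f ∈ window E L h) : Near E (2 * L) h f := by
  obtain ⟨i, hi, rfl⟩ := mem_window.1 hf
  exact (near_iterate_fwd E i h).mono (by omega)

theorem Agree.window_eq (A : Agree E E' r h) (hr : 2 * L ≤ r) : window E L h = window E' L h :=
  Finset.image_congr fun i hi => A.iterate_fwd_eq (by have := Finset.mem_range.1 hi; omega)

/-- The trails are divided into windows of length `L`, and one of them starts with `h`. A window
contains no half-edge of the ruling set except possibly the first one, and no end of a trail. -/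
def IsStart (E : Incidence) (L β : ℕ) (h : HalfEdge) : Prop :=
  L ∣ lag E L β h ∧ (∀ i, 1 ≤ i → i < L → ¬ Ruling E L β ((fwd E)^[i] h)) ∧
    ∀ f ∈ window E L h, mate E f ≠ f

theorem IsStart.eq_of_iterate_eq (hE : IsIncidence E) (hh : IsStart E L β h)
    (hg : IsStart E L β g) (hi : i < L) (hj : j < L) (H : (fwd E)^[i] h = (fwd E)^[j] g) :
    i = j ∧ h = g := by
  have hlag := lag_iterate_fwd hE (j := i) fun i' h1 h2 => hh.2.1 i' h1 (by omega)
  rw [H, lag_iterate_fwd hE fun j' h1 h2 => hg.2.1 j' h1 (by omega)] at hlag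
  obtain ⟨a, ha⟩ := hh.1
  obtain ⟨b, hb⟩ := hg.1
  have hij : i = j := by
    have := congrArg (· % L) hlag
    simpa [ha, hb, Nat.mod_eq_of_lt hi, Nat.mod_eq_of_lt hj] using this.symm
  subst hij
  exact ⟨rfl, hE.bwd_fwd.injective.iterate i H⟩

theorem IsStart.card_window (hE : IsIncidence E) (hh : IsStart E L β h) :
    (window E L h).card = L := by
  rw [window, Finset.card_image_of_injOn, Finset.card_range]
  intro i hi j hj H
  exact (hh.eq_of_iterate_eq hE hh (Finset.mem_range.1 hi) (Finset.mem_range.1 hj) H).1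

theorem IsStart.disjoint_window (hE : IsIncidence E) (hh : IsStart E L β h)
    (hg : IsStart E L β g) (hne : h ≠ g) : Disjoint (window E L h) (window E L g) := by
  refine Finset.disjoint_left.2 fun f hf hf' => hne ?_
  obtain ⟨i, hi, rfl⟩ := mem_window.1 hf
  obtain ⟨j, hj, H⟩ := mem_window.1 hf'
  exact (hh.eq_of_iterate_eq hE hg hi hj H.symm).2

theorem exists_isStart_of_not_ruling (hE : IsIncidence E) (hL : 0 < L)
    (hend : ∀ i ≤ 2 * L, mate E ((fwd E)^[i] h) ≠ (fwd E)^[i] h)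
    (hr : ∀ i, 1 ≤ i → i ≤ 2 * L → ¬ Ruling E L β ((fwd E)^[i] h)) :
    ∃ i < L, IsStart E L β ((fwd E)^[i] h) := by
  obtain ⟨s, hs, hdvd⟩ : ∃ s < L, L ∣ lag E L β h + s := by
    have hmod := Nat.mod_lt (lag E L β h) hL
    rcases Nat.eq_zero_or_pos (lag E L β h % L) with h0 | h0
    · exact ⟨0, hL, Nat.dvd_of_mod_eq_zero h0⟩
    · refine ⟨L - lag E L β h % L, by omega, lag E L β h / L + 1, ?_⟩
      have := Nat.div_add_mod (lag E L β h) L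
      rw [Nat.mul_add]
      omega
  refine ⟨s, hs, ?_, fun i h1 h2 => ?_, fun f hf => ?_⟩
  · rwa [lag_iterate_fwd hE fun i h1 h2 => hr i h1 (by omega)]
  · rw [← Function.iterate_add_apply]
    exact hr _ (by omega) (by omega)
  · obtain ⟨i, hi, rfl⟩ := mem_window.1 hf
    rw [← Function.iterate_add_apply]
    exact hend _ (by omega)

theorem isStart_or_cycle_of_ruling (hE : IsIncidence E)
    (hcode : ∀ h, E h h → code h < 2 ^ β) (hv : E h h) (hr : Ruling E L β h)
    (hend : ∀ i ≤ L, mate E ((fwd E)^[i] h) ≠ (fwd E)^[i] h) :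
    IsStart E L β h ∨ ∃ p, 1 ≤ p ∧ p < L ∧ (fwd E)^[p] h = h := by
  by_cases hnext : ∀ i, 1 ≤ i → i < L → ¬ Ruling E L β ((fwd E)^[i] h)
  · refine Or.inl ⟨by simp [lag_eq_zero hr], hnext, fun f hf => ?_⟩
    obtain ⟨i, hi, rfl⟩ := mem_window.1 hf
    exact hend i hi.le
  · push Not at hnext
    obtain ⟨p, hp1, hp, hr'⟩ := hnext
    exact Or.inr ⟨p, hp1, hp, hr'.eq_of_onTrail hE hr (hcode _ (hE.iterate_fwd_valid hv p))
      (hcode _ hv) ⟨p, hp.le, Or.inl rfl⟩⟩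

theorem exists_end_or_isStart_or_cycle (hE : IsIncidence E) (hL : 0 < L)
    (hcode : ∀ h, E h h → code h < 2 ^ β) (hv : E h h) :
    (∃ i ≤ 3 * L, mate E ((fwd E)^[i] h) = (fwd E)^[i] h) ∨
    (∃ i ≤ 2 * L, IsStart E L β ((fwd E)^[i] h)) ∨
    ∃ p, 1 ≤ p ∧ p < L ∧ (fwd E)^[p] h = h := by
  by_cases hend : ∃ i ≤ 3 * L, mate E ((fwd E)^[i] h) = (fwd E)^[i] h
  · exact Or.inl hend
  push Not at hend
  refine Or.inr ?_
  by_cases hr : ∀ i, 1 ≤ i → i ≤ 2 * L → ¬ Ruling E L β ((fwd E)^[i] h)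
  · obtain ⟨i, hi, hs⟩ := exists_isStart_of_not_ruling hE hL (fun i hi => hend i (by omega)) hr
    exact Or.inl ⟨i, by omega, hs⟩
  · push Not at hr
    obtain ⟨j, -, hj, hr⟩ := hr
    rcases isStart_or_cycle_of_ruling hE hcode (hE.iterate_fwd_valid hv j) hr fun i hi => by
      rw [← Function.iterate_add_apply]; exact hend _ (by omega) with hs | ⟨p, hp1, hp, hcycle⟩
    · exact Or.inl ⟨j, hj, hs⟩
    · refine Or.inr ⟨p, hp1, hp, hE.bwd_fwd.injective.iterate j ?_⟩
      rwa [← Function.iterate_add_apply, Nat.add_comm, Function.iterate_add_apply]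

theorem Agree.isStart_iff (A : Agree E E' r h) (hr : 6 * (L * β) + 2 * L ≤ r) :
    IsStart E L β h ↔ IsStart E' L β h := by
  have hnear : ∀ {f}, f ∈ window E L h → Agree E E' (6 * (L * β)) f := fun hf =>
    A.of_near (near_of_mem_window hf) (by omega)
  rw [IsStart, IsStart, A.lag_eq (by omega), ← A.window_eq (by omega)]
  refine and_congr_right' (and_congr (forall₃_congr fun i _ hi => ?_)
    (forall₂_congr fun f hf => by rw [(hnear hf).mate_eq]))
  rw [← A.iterate_fwd_eq (j := i) (by omega)]
  exact not_congr ((hnear (mem_window.2 ⟨i, hi, rfl⟩)).ruling_iff (by omega))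

end Window

section FirstMem

variable {α : Type*} [Encodable α] [Inhabited α] {𝒱 𝒲 : Set α}

open Classical in
/-- The member of `𝒱` that comes first in the enumeration of `α`, or the default element of `α` if
`𝒱` is empty. All nodes that know `𝒱` make the same choice. -/
noncomputable def firstMem (𝒱 : Set α) : α :=
  if h : 𝒱.Nonempty then Function.argminOn Encodable.encode 𝒱 h else default

theorem firstMem_mem (h : 𝒱.Nonempty) : firstMem 𝒱 ∈ 𝒱 := by
  rw [firstMem, dif_pos h]
  exact Function.argminOn_mem _ _ _

theorem firstMem_mem_of_ne_default (h : firstMem 𝒱 ≠ default) : firstMem 𝒱 ∈ 𝒱 := by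
  refine firstMem_mem (not_not.1 fun hne => h ?_)
  rw [firstMem, dif_neg hne]

theorem encode_firstMem_le {a : α} (ha : a ∈ 𝒱) :
    Encodable.encode (firstMem 𝒱) ≤ Encodable.encode a := by
  rw [firstMem, dif_pos ⟨a, ha⟩]
  exact Function.argminOn_le Encodable.encode 𝒱 ha

theorem firstMem_eq_of_subset (h : 𝒱 ⊆ 𝒲) (hm : firstMem 𝒲 ∈ 𝒱) : firstMem 𝒱 = firstMem 𝒲 :=
  Encodable.encode_injective
    (le_antisymm (encode_firstMem_le hm) (encode_firstMem_le (h (firstMem_mem ⟨_, hm⟩))))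

end FirstMem

section Cut

variable {E E' : Incidence} {r L β : ℕ} {h g x : HalfEdge} {Q : Finset HalfEdge}

/-- `E` describes a graph whose nodes have degree at most `L / 2` and whose half-edges have codes of
`β` bits. -/
structure IsBounded (E : Incidence) (L β : ℕ) : Prop extends IsIncidence E where
  two_mul_ncard_node_le : ∀ h, 2 * (node E h).ncard ≤ L
  code_lt : ∀ h, E h h → code h < 2 ^ β

namespace IsBounded

theorem length_pos (hE : IsBounded E L β) (hv : E h h) : 0 < L := by
  have h1 := hE.two_mul_ncard_node_le h
  have h2 : 0 < (node E h).ncard := (Set.ncard_pos (hE.finite h)).2 ⟨h, hv⟩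
  omega

-- The code `0` belongs to the pair `(0, 0)`, which is no half-edge.
theorem image_code_subset (hE : IsBounded E L β) :
    code '' {h | E h h} ⊆ Finset.Ico 1 (2 ^ β) := by
  rintro _ ⟨h, hv, rfl⟩
  rw [Finset.mem_coe, Finset.mem_Ico]
  refine ⟨Nat.one_le_iff_ne_zero.2 fun h0 => ?_, hE.code_lt h hv⟩
  have : h = (0, 0) := code_injective h0
  exact hE.swap_ne hv (by rw [this]; rfl)

theorem finite_valid (hE : IsBounded E L β) : {h | E h h}.Finite :=
  ((Finset.finite_toSet _).subset hE.image_code_subset).of_finite_image code_injective.injOn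

theorem ncard_valid_lt (hE : IsBounded E L β) : {h | E h h}.ncard < 2 ^ β := by
  have h1 := Set.ncard_le_ncard hE.image_code_subset (Finset.finite_toSet _)
  rw [Set.ncard_image_of_injective _ code_injective, Set.ncard_coe_finset, Nat.card_Ico] at h1
  have h2 := Nat.two_pow_pos β
  omega

end IsBounded

/-- The half-edges of the graph at which a window starts. -/
abbrev Start (E : Incidence) (L β : ℕ) := {x // E x x ∧ IsStart E L β x}

open Classical in
/-- The nodes through which the window that starts with `h` passes. -/
noncomputable def windowNodes (E : Incidence) (L : ℕ) (h : HalfEdge) : Finset (Set HalfEdge) :=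
  (window E L h).image (node E)

theorem mem_windowNodes {C : Set HalfEdge} :
    C ∈ windowNodes E L h ↔ ∃ f ∈ window E L h, node E f = C :=
  Finset.mem_image

theorem IsIncidence.window_valid (hE : IsIncidence E) (hv : E h h) (hg : g ∈ window E L h) :
    E g g :=
  hE.near_valid hv (near_of_mem_window hg)

theorem near_of_windowNodes (hE : IsIncidence E) (hv : E h h) {C : Set HalfEdge}
    (hC : C ∈ windowNodes E L h) (hC' : C ∈ windowNodes E L g) : Near E (4 * L + 1) h g := by
  obtain ⟨f, hf, rfl⟩ := mem_windowNodes.1 hC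
  obtain ⟨f', hf', H⟩ := mem_windowNodes.1 hC'
  have hrel : E f f' := hE.symm (rel_of_node_eq (hE.window_valid hv hf) H)
  exact (((near_of_mem_window hf).rel hrel).trans (hE.near_symm (near_of_mem_window hf'))).mono
    (by omega)

open Classical in
theorem IsBounded.two_mul_card_le (hE : IsBounded E L β) (A : Finset (Start E L β)) :
    2 * A.card ≤ (A.biUnion fun x => windowNodes E L x.1).card := by
  rcases A.eq_empty_or_nonempty with rfl | ⟨x₀, -⟩
  · simp
  set W := A.biUnion fun x => window E L x.1
  set B := A.biUnion fun x => windowNodes E L x.1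
  have hW : W.card = A.card * L := by
    rw [Finset.card_biUnion fun x _ y _ hxy => x.2.2.disjoint_window hE.toIsIncidence y.2.2
      (Subtype.coe_injective.ne hxy),
      Finset.sum_congr rfl fun x _ => x.2.2.card_window hE.toIsIncidence, Finset.sum_const,
      smul_eq_mul]
  have hfiber : ∀ C ∈ B, (W.filter fun f => node E f = C).card ≤ L / 2 := fun C hC => by
    obtain ⟨x, -, hx⟩ := Finset.mem_biUnion.1 hC
    obtain ⟨f, -, rfl⟩ := mem_windowNodes.1 hx
    refine le_trans ?_ ((Nat.le_div_iff_mul_le two_pos).2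
      ((Nat.mul_comm _ _).trans_le (hE.two_mul_ncard_node_le f)))
    rw [← Set.ncard_coe_finset]
    refine Set.ncard_le_ncard (fun g hg => ?_) (hE.finite f)
    obtain ⟨hgW, hgf⟩ := Finset.mem_filter.1 hg
    obtain ⟨y, -, hy⟩ := Finset.mem_biUnion.1 hgW
    exact rel_of_node_eq (hE.window_valid y.2.1 hy) hgf.symm
  have hWB := Finset.card_le_mul_card_image_of_maps_to (t := B) (fun f hf => by
    obtain ⟨y, hy, hf⟩ := Finset.mem_biUnion.1 hf
    exact Finset.mem_biUnion.2 ⟨y, hy, mem_windowNodes.2 ⟨f, hf, rfl⟩⟩) (L / 2) hfiber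
  refine Nat.le_of_mul_le_mul_left ?_ (hE.length_pos x₀.2.1)
  calc L * (2 * A.card) = 2 * W.card := by rw [hW]; ring
    _ ≤ 2 * (L / 2) * B.card := by rw [Nat.mul_assoc]; exact Nat.mul_le_mul_left 2 hWB
    _ ≤ L * B.card := Nat.mul_le_mul_right _ (Nat.mul_div_le L 2)

theorem IsBounded.exists_isClosedMatching_windowNodes (hE : IsBounded E L β) (x : Start E L β) :
    ∃ (S : Finset (Start E L β)) (f : Start E L β → Set HalfEdge), x ∈ S ∧
      IsClosedMatching (fun z => windowNodes E L z.1) S f ∧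
      ∀ z ∈ S, Near E (β * (4 * L + 1)) x.1 z.1 := by
  classical
  have : Finite (Start E L β) :=
    hE.finite_valid.subset (s := {x | E x x}) (t := {x | E x x ∧ IsStart E L β x}) fun _ h => h.1
  have := Fintype.ofFinite (Start E L β)
  have hcard : Fintype.card (Start E L β) < 2 ^ β := by
    rw [← Nat.card_eq_fintype_card]
    exact (Set.ncard_le_ncard (s := {x | E x x ∧ IsStart E L β x}) (fun _ h => h.1)
      hE.finite_valid).trans_lt hE.ncard_valid_lt
  let ball (t : ℕ) : Finset (Start E L β) := {z | Near E (t * (4 * L + 1)) x.1 z.1}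
  have mem_ball : ∀ {t z}, z ∈ ball t ↔ Near E (t * (4 * L + 1)) x.1 z.1 := by simp [ball]
  obtain ⟨S, f, hS, hx, hf⟩ := exists_isClosedMatching (x₀ := x) (m := β)
    (ball := ball) hE.two_mul_card_le
    (fun s t hst z hz => mem_ball.2 ((mem_ball.1 hz).mono (Nat.mul_le_mul_right _ hst)))
    (fun t z hz C hC z' hC' => mem_ball.2 (by
      rw [Nat.succ_mul]
      exact (mem_ball.1 hz).trans (near_of_windowNodes hE.toIsIncidence z.2.1 hC hC')))
    (mem_ball.2 (near_self E _ _)) ((Finset.card_le_univ _).trans_lt hcard)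
  exact ⟨S, f, hx, hf, fun z hz => mem_ball.1 (hS hz)⟩

/-- The diameter of the cut sets considered: two members are each at the end of a path that runs
from a common window through `β` other windows to a last one, and within it to the member. -/
def cutRadius (L β : ℕ) : ℕ := 2 * (β * (4 * L + 1) + 2 * L)

/-- A set of at most one half-edge per node that meets all the windows passing through the nodes
of its members. -/
structure IsCutSet (E : Incidence) (L β : ℕ) (Q : Finset HalfEdge) : Prop where
  unique : ∀ g ∈ Q, ∀ g' ∈ Q, E g g' → g = g'
  hits : ∀ g ∈ Q, ∀ x, Near E (2 * L + 1) g x → IsStart E L β x → ∀ f ∈ window E L x, E g f →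
    ∃ q ∈ window E L x, q ∈ Q
  near : ∀ g ∈ Q, ∀ g' ∈ Q, Near E (cutRadius L β) g g'

open Classical in
theorem isCutSet_image (hE : IsIncidence E) {S : Finset (Start E L β)}
    {f : Start E L β → Set HalfEdge} (hf : IsClosedMatching (fun z => windowNodes E L z.1) S f)
    (hS : ∀ z ∈ S, Near E (β * (4 * L + 1)) x z.1) {c : Start E L β → HalfEdge}
    (hc : ∀ z ∈ S, c z ∈ window E L z.1) (hcf : ∀ z ∈ S, node E (c z) = f z) :
    IsCutSet E L β (S.image c) := by
  have hnear : ∀ z ∈ S, Near E (β * (4 * L + 1) + 2 * L) x (c z) := fun z hz =>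
    (hS z hz).trans (near_of_mem_window (hc z hz))
  refine ⟨?_, ?_, ?_⟩ <;> simp only [Finset.forall_mem_image]
  · intro z hz z' hz' hzz
    rw [hf.1 hz hz' (by rw [← hcf z hz, ← hcf z' hz', hE.node_eq hzz])]
  · intro z hz y hy hys g hg hzg
    have hyv : E y y := hE.near_valid (hE.window_valid z.2.1 (hc z hz)) hy
    have hyS : ⟨y, hyv, hys⟩ ∈ S :=
      (hf.2 z hz).2 _ (mem_windowNodes.2 ⟨g, hg, by rw [← hcf z hz, hE.node_eq hzg]⟩)
    exact ⟨_, hc _ hyS, Finset.mem_image_of_mem c hyS⟩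
  · intro z hz z' hz'
    exact ((hE.near_symm (hnear z hz)).trans (hnear z' hz')).mono (by rw [cutRadius]; omega)

theorem IsBounded.exists_isCutSet (hE : IsBounded E L β) (x : Start E L β) :
    ∃ Q, IsCutSet E L β Q ∧ ∃ q ∈ window E L x.1, q ∈ Q := by
  classical
  obtain ⟨S, f, hx, hf, hS⟩ := hE.exists_isClosedMatching_windowNodes x
  have hchoice : ∀ z, ∃ q, z ∈ S → q ∈ window E L z.1 ∧ node E q = f z := fun z => by
    by_cases hz : z ∈ S
    · obtain ⟨q, hq⟩ := mem_windowNodes.1 (hf.2 z hz).1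
      exact ⟨q, fun _ => hq⟩
    · exact ⟨z.1, fun h => absurd h hz⟩
  choose c hc using hchoice
  exact ⟨S.image c, isCutSet_image hE.toIsIncidence hf hS (fun z hz => (hc z hz).1)
    fun z hz => (hc z hz).2, c x, (hc x hx).1, Finset.mem_image_of_mem c hx⟩

/-- The cut sets with a member at the node of `h`. -/
def cutSets (E : Incidence) (L β : ℕ) (h : HalfEdge) : Set (Finset HalfEdge) :=
  {Q | IsCutSet E L β Q ∧ ∃ g ∈ Q, E h g}

/-- The half-edges at which the trails are cut. -/
def IsCut (E : Incidence) (L β : ℕ) (h : HalfEdge) : Prop := h ∈ firstMem (cutSets E L β h)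

theorem IsIncidence.cutSets_eq (hE : IsIncidence E) (H : E h g) :
    cutSets E L β h = cutSets E L β g :=
  Set.ext fun _ => and_congr_right' <| exists_congr fun _ => and_congr_right'
    ⟨hE.trans (hE.symm H), hE.trans H⟩

theorem IsCut.eq (hE : IsIncidence E) (hh : IsCut E L β h) (hg : IsCut E L β g) (H : E h g) :
    h = g := by
  rw [IsCut, ← hE.cutSets_eq H] at hg
  have hmem := firstMem_mem_of_ne_default (Finset.ne_empty_of_mem hh)
  exact hmem.1.unique h hh g hg H

-- The first of all the cut sets with a member at some node of the window has a member in the window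
-- itself, and it is the first one for the node of that member, too.
theorem IsBounded.exists_isCut (hE : IsBounded E L β) (hv : E x x) (hx : IsStart E L β x) :
    ∃ q ∈ window E L x, IsCut E L β q := by
  obtain ⟨Q, hQ, q, hqx, hqQ⟩ := hE.exists_isCutSet ⟨x, hv, hx⟩
  set 𝒲 : Set (Finset HalfEdge) := {Q | ∃ f ∈ window E L x, Q ∈ cutSets E L β f}
  have hne : 𝒲.Nonempty := ⟨Q, q, hqx, hQ, q, hqQ, hE.window_valid hv hqx⟩
  obtain ⟨f, hf, hcut, g, hg, hfg⟩ := firstMem_mem hne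
  have hgx : Near E (2 * L + 1) g x := hE.near_symm ((near_of_mem_window hf).rel hfg)
  obtain ⟨q', hqx', hqQ'⟩ := hcut.hits g hg x hgx hx f hf (hE.symm hfg)
  refine ⟨q', hqx', ?_⟩
  rw [IsCut, firstMem_eq_of_subset (𝒲 := 𝒲) (fun _ hQ => ⟨q', hqx', hQ⟩)
    ⟨hcut, q', hqQ', hE.window_valid hv hqx'⟩]
  exact hqQ'

theorem Agree.isCutSet_iff (A : Agree E E' r h)
    (hr : 2 * cutRadius L β + 6 * (L * β) + 4 * L + 2 ≤ r)
    (hQ : ∀ g ∈ Q, Near E (cutRadius L β + 1) h g) : IsCutSet E L β Q ↔ IsCutSet E' L β Q := by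
  have hA : ∀ g ∈ Q, Agree E E' (cutRadius L β + 6 * (L * β) + 4 * L + 1) g := fun g hg =>
    A.of_near (hQ g hg) (by omega)
  have hunique : (∀ g ∈ Q, ∀ g' ∈ Q, E g g' → g = g') ↔ ∀ g ∈ Q, ∀ g' ∈ Q, E' g g' → g = g' :=
    forall₂_congr fun g hg => forall₂_congr fun g' _ => by rw [(hA g hg).rel_iff g']
  have hnear : (∀ g ∈ Q, ∀ g' ∈ Q, Near E (cutRadius L β) g g') ↔
      ∀ g ∈ Q, ∀ g' ∈ Q, Near E' (cutRadius L β) g g' :=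
    forall₂_congr fun g hg => forall₂_congr fun g' _ =>
      ((hA g hg).mono (by omega)).near_iff g'
  have hhits : (∀ g ∈ Q, ∀ x, Near E (2 * L + 1) g x → IsStart E L β x → ∀ f ∈ window E L x,
        E g f → ∃ q ∈ window E L x, q ∈ Q) ↔
      ∀ g ∈ Q, ∀ x, Near E' (2 * L + 1) g x → IsStart E' L β x → ∀ f ∈ window E' L x,
        E' g f → ∃ q ∈ window E' L x, q ∈ Q := by
    refine forall₂_congr fun g hg => forall_congr' fun x => ?_
    rw [← ((hA g hg).mono (show 2 * L + 1 ≤ _ by omega)).near_iff x]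
    refine imp_congr_right fun hx => ?_
    have hAx : Agree E E' (6 * (L * β) + 2 * L) x := (hA g hg).of_near hx (by omega)
    simp only [hAx.isStart_iff le_rfl, hAx.window_eq (Nat.le_add_left _ _), (hA g hg).rel_iff]
  exact ⟨fun H => ⟨hunique.1 H.unique, hhits.1 H.hits, hnear.1 H.near⟩,
    fun H => ⟨hunique.2 H.unique, hhits.2 H.hits, hnear.2 H.near⟩⟩

theorem Agree.isCut_iff (A : Agree E E' r h)
    (hr : 2 * cutRadius L β + 6 * (L * β) + 4 * L + 2 ≤ r) :
    IsCut E L β h ↔ IsCut E' L β h := by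
  suffices cutSets E L β h = cutSets E' L β h by rw [IsCut, this, IsCut]
  ext Q
  refine ⟨fun ⟨H, g, hg, hhg⟩ => ⟨(A.isCutSet_iff hr fun f hf => ?_).1 H, g, hg,
    (A.rel_iff g).1 hhg⟩, fun ⟨H, g, hg, hhg⟩ => ?_⟩
  · rw [Nat.add_comm]
    exact (near_one_of_rel hhg).trans (H.near g hg f hf)
  · have hhg' := (A.rel_iff g).2 hhg
    have hnear := near_one_of_rel hhg'
    refine ⟨(A.isCutSet_iff hr fun f hf => ?_).2 H, g, hg, hhg'⟩
    have hgf := ((A.of_near (t := cutRadius L β) hnear (by omega)).near_iff f).2 (H.near g hg f hf)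
    rw [Nat.add_comm]
    exact hnear.trans hgf

end Cut

section Support

variable {E K : Incidence} {r s n m ℓ : ℕ} {h g a b d q : HalfEdge} {S T : Set HalfEdge}
  {F F' : Finset HalfEdge}

/-- `K` joins certain half-edges that lie at the same node of the graph described by `E`. -/
structure IsJoining (E K : Incidence) : Prop where
  symm : ∀ ⦃h g⦄, K h g → K g h
  trans : ∀ ⦃h g f⦄, K h g → K g f → K h f
  le : ∀ ⦃h g⦄, K h g → E h g

/-- `p` is joined with a second half-edge in `F`, or with no second half-edge at all. -/
def Saturated (K : Incidence) (F : Finset HalfEdge) (p : HalfEdge) : Prop :=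
  (∀ q, K p q → q = p) ∨ ∃ q ∈ F, q ≠ p ∧ K p q

theorem Saturated.mono {p : HalfEdge} (H : Saturated K F p) (hF : F ⊆ F') : Saturated K F' p :=
  H.imp_right fun ⟨q, hq, H⟩ => ⟨q, hF hq, H⟩

/-- A set of edges, given by both their halves, all of whose half-edges are saturated except for
those in `S`. -/
structure IsSupport (K : Incidence) (S : Set HalfEdge) (F : Finset HalfEdge) : Prop where
  swap : ∀ p ∈ F, p.swap ∈ F
  saturated : ∀ p ∈ F, p ∉ S → Saturated K F p

theorem isSupport_pair [DecidableEq HalfEdge] (K : Incidence) (h : HalfEdge) :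
    IsSupport K {h, h.swap} {h, h.swap} :=
  ⟨by simp, by simp⟩

namespace IsSupport

theorem of_saturated (H : IsSupport K S F) (hT : ∀ p ∈ S, p ∉ T → Saturated K F p) :
    IsSupport K T F :=
  ⟨H.swap, fun p hp hpT => (Classical.em (p ∈ S)).elim (fun hpS => hT p hpS hpT)
    (H.saturated p hp)⟩

theorem union [DecidableEq HalfEdge] (H : IsSupport K S F) (H' : IsSupport K T F') :
    IsSupport K (S ∪ T) (F ∪ F') := by
  refine ⟨fun p hp => ?_, fun p hp hpST => ?_⟩
  · exact Finset.mem_union.2 ((Finset.mem_union.1 hp).imp (H.swap p) (H'.swap p))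
  · rw [Set.mem_union, not_or] at hpST
    rcases Finset.mem_union.1 hp with hp | hp
    · exact (H.saturated p hp hpST.1).mono Finset.subset_union_left
    · exact (H'.saturated p hp hpST.2).mono Finset.subset_union_right

theorem join (H : IsSupport K S F) (hK : IsJoining E K) (ha : a ∈ F) (hb : b ∈ F) (hab : a ≠ b)
    (hKab : K a b) (hT : ∀ p ∈ S, p = a ∨ p = b ∨ p ∈ T) : IsSupport K T F := by
  refine H.of_saturated fun p hp hpT => ?_
  rcases hT p hp with rfl | rfl | hpT'
  · exact Or.inr ⟨b, hb, hab.symm, hKab⟩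
  · exact Or.inr ⟨a, ha, hab, hK.symm hKab⟩
  · exact absurd hpT' hpT

end IsSupport

/-- A trail that leaves through `h` can go on with `g`. -/
def Succ (K : Incidence) (h g : HalfEdge) : Prop := K h.swap g ∧ g ≠ h.swap

/-- A trail that leaves through `h` can reach `g` in `n` steps. -/
def Reach (K : Incidence) : ℕ → HalfEdge → HalfEdge → Prop
  | 0, h, g => g = h
  | n + 1, h, g => ∃ f, Reach K n h f ∧ Succ K f g

namespace Reach

theorem near (hK : IsJoining E K) (H : Reach K n h g) : Near E (2 * n) h g := by
  induction n generalizing g with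
  | zero => exact H
  | succ n ih =>
    obtain ⟨f, hf, hfg⟩ := H
    exact (ih hf).swap.rel (hK.le hfg.1)

theorem cons (hg : Succ K h g) (H : Reach K n g q) : Reach K (n + 1) h q := by
  induction n generalizing q with
  | zero => cases H; exact ⟨h, rfl, hg⟩
  | succ n ih =>
    obtain ⟨f, hf, hfq⟩ := H
    exact ⟨f, ih hf, hfq⟩

theorem trans (H : Reach K n h g) (H' : Reach K m g q) : Reach K (n + m) h q := by
  induction m generalizing q with
  | zero => cases H'; exact H
  | succ m ih =>
    obtain ⟨f, hf, hfq⟩ := H'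
    exact ⟨f, ih hf, hfq⟩

theorem exists_isSupport (hK : IsJoining E K) (H : Reach K n h q) :
    ∃ F, h ∈ F ∧ q ∈ F ∧ IsSupport K {h, q.swap} F ∧ ∀ p ∈ F, Near E (2 * n + 1) h p := by
  classical
  induction n generalizing q with
  | zero =>
    cases H
    refine ⟨{h, h.swap}, by simp, by simp, isSupport_pair K h, ?_⟩
    simp [near_self, near_one_swap]
  | succ n ih =>
    have hhq := H.near hK
    obtain ⟨f, hf, hKfq, hne⟩ := H
    obtain ⟨F, hh, hfF, hF, hnear⟩ := ih hf
    refine ⟨F ∪ {q, q.swap}, by simp [hh], by simp, ?_, fun p hp => ?_⟩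
    · exact (hF.union (isSupport_pair K q)).join hK (a := f.swap) (b := q)
        (by simp [hF.swap f hfF]) (by simp) hne.symm hKfq (by simp)
    · simp only [Finset.mem_union, Finset.mem_insert, Finset.mem_singleton] at hp
      rcases hp with hp | rfl | rfl
      · exact (hnear p hp).mono (by omega)
      · exact hhq.succ
      · exact hhq.swap

end Reach

/-- Within distance `r` from `h`, some edges including that of `h` have all their half-edges
saturated except possibly `h` itself. -/
def HasAnchor (E K : Incidence) (r : ℕ) (h : HalfEdge) : Prop :=
  ∃ F, h ∈ F ∧ IsSupport K {h} F ∧ ∀ p ∈ F, Near E r h p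

namespace HasAnchor

theorem mono (H : HasAnchor E K r h) (hs : r ≤ s) : HasAnchor E K s h := by
  obtain ⟨F, hh, hF, hnear⟩ := H
  exact ⟨F, hh, hF, fun p hp => (hnear p hp).mono hs⟩

theorem of_leaf (H : ∀ q, K h.swap q → q = h.swap) : HasAnchor E K 1 h := by
  classical
  refine ⟨{h, h.swap}, by simp, (isSupport_pair K h).of_saturated ?_, ?_⟩
  · simp only [Set.mem_insert_iff, Set.mem_singleton_iff]
    rintro p (rfl | rfl) hp
    · exact absurd rfl hp
    · exact Or.inl H
  · simp [near_self, near_one_swap]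

theorem of_succ (hK : IsJoining E K) (hg : Succ K h g) (H : HasAnchor E K r g) :
    HasAnchor E K (r + 2) h := by
  classical
  obtain ⟨F, hgF, hF, hnear⟩ := H
  refine ⟨F ∪ {h, h.swap}, by simp, ?_, fun p hp => ?_⟩
  · exact (hF.union (isSupport_pair K h)).join hK (a := h.swap) (b := g) (by simp)
      (by simp [hgF]) hg.2.symm hg.1 (by simp)
  · simp only [Finset.mem_union, Finset.mem_insert, Finset.mem_singleton] at hp
    rcases hp with hp | rfl | rfl
    · rw [Nat.add_comm]
      exact ((near_one_swap E h).rel (hK.le hg.1)).trans (hnear p hp)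
    · exact near_self E _ _
    · exact (near_one_swap E _).mono (by omega)

theorem of_reach (hK : IsJoining E K) (hg : Reach K n h g) (H : HasAnchor E K r g) :
    HasAnchor E K (r + 2 * n) h := by
  induction n generalizing g r with
  | zero => cases hg; exact H
  | succ n ih =>
    obtain ⟨f, hf, hfg⟩ := hg
    exact (ih hf (H.of_succ hK hfg)).mono (by omega)

theorem of_common_succ (hK : IsJoining E K) (ha : Reach K n h a) (hb : Reach K m h b)
    (hab : a ≠ b) (had : Succ K a d) (hbd : Succ K b d) (hn : 2 * n + 1 ≤ r)
    (hm : 2 * m + 1 ≤ r) : HasAnchor E K r h := by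
  classical
  obtain ⟨F, hh, haF, hF, hnear⟩ := ha.exists_isSupport hK
  obtain ⟨F', -, hbF, hF', hnear'⟩ := hb.exists_isSupport hK
  refine ⟨F ∪ F', by simp [hh], ?_, fun p hp => ?_⟩
  · exact (hF.union hF').join hK (a := a.swap) (b := b.swap) (by simp [hF.swap a haF])
      (by simp [hF'.swap b hbF]) (Prod.swap_injective.ne hab)
      (hK.trans had.1 (hK.symm hbd.1)) (by simp)
  · rcases Finset.mem_union.1 hp with hp | hp
    · exact (hnear p hp).mono hn
    · exact (hnear' p hp).mono hm

theorem of_cycle (hK : IsJoining E K) (ha : Reach K n h a) (hg : Succ K a g) (hga : Reach K m g a)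
    (hr : 2 * (n + m) + 3 ≤ r) : HasAnchor E K r h := by
  classical
  have hhg : Near E (2 * (n + 1)) h g := Reach.near hK ⟨a, ha, hg⟩
  obtain ⟨F, hh, haF, hF, hnear⟩ := ha.exists_isSupport hK
  obtain ⟨F', hgF, -, hF', hnear'⟩ := hga.exists_isSupport hK
  refine ⟨F ∪ F', by simp [hh], ?_, fun p hp => ?_⟩
  · exact (hF.union hF').join hK (a := a.swap) (b := g) (by simp [hF.swap a haF])
      (by simp [hgF]) hg.2.symm hg.1 (by simp)
  · rcases Finset.mem_union.1 hp with hp | hp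
    · exact (hnear p hp).mono (by omega)
    · exact (hhg.trans (hnear' p hp)).mono (by omega)

theorem of_branch_reach (hK : IsJoining E K) (ha : Reach K n h a) (hg : Succ K a g)
    (hd : Succ K a d) (hgd : Reach K (m + 1) g d) (hr : 2 * (n + m) + 3 ≤ r) :
    HasAnchor E K r h := by
  obtain ⟨q, hgq, hqd⟩ := hgd
  by_cases hqa : a = q
  · subst hqa
    exact of_cycle hK ha hg hgq hr
  · exact of_common_succ hK ha (ha.trans (hgq.cons hg)) hqa hd hqd (by omega) (by omega)

theorem of_branches_meet (hK : IsJoining E K) {g₁ g₂ : HalfEdge} {n₁ n₂ N : ℕ}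
    (ha : Reach K n h a) (hg₁ : Succ K a g₁) (hg₂ : Succ K a g₂) (hne : g₁ ≠ g₂)
    (h₁ : Reach K n₁ g₁ d) (h₂ : Reach K n₂ g₂ d) (hn₁ : n₁ ≤ N) (hn₂ : n₂ ≤ N) :
    HasAnchor E K (2 * (n + N) + 3) h := by
  induction n₁ generalizing d n₂ with
  | zero =>
    cases h₁
    cases n₂ with
    | zero => exact absurd h₂ hne
    | succ s => exact of_branch_reach hK ha hg₂ hg₁ h₂ (by omega)
  | succ s ih =>
    cases n₂ with
    | zero =>
      cases h₂
      exact of_branch_reach hK ha hg₁ hg₂ h₁ (by omega)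
    | succ s' =>
      obtain ⟨q₁, hq₁, hqd₁⟩ := h₁
      obtain ⟨q₂, hq₂, hqd₂⟩ := h₂
      by_cases hq : q₁ = q₂
      · subst hq
        exact ih hq₁ hq₂ (by omega) (by omega)
      · exact of_common_succ hK (ha.trans (hq₁.cons hg₁)) (ha.trans (hq₂.cons hg₂)) hq hqd₁ hqd₂
          (by omega) (by omega)

end HasAnchor

/-- A trail that leaves through `h` can go on in two ways after fewer than `ℓ` steps. -/
def Branches (K : Incidence) (ℓ : ℕ) (h : HalfEdge) : Prop :=
  ∃ n < ℓ, ∃ a g₁ g₂, Reach K n h a ∧ Succ K a g₁ ∧ Succ K a g₂ ∧ g₁ ≠ g₂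

theorem exists_hasAnchor_or_two_pow_le_card (hE : IsIncidence E) (hK : IsJoining E K)
    (hdense : ∀ h, E h h → HasAnchor E K (2 * ℓ + 1) h ∨ Branches K ℓ h) (m : ℕ) (hv : E h h) :
    HasAnchor E K (2 * (m * ℓ) + 2 * ℓ + 1) h ∨
      ∃ D : Finset HalfEdge, 2 ^ m ≤ D.card ∧ ∀ d ∈ D, ∃ n ≤ m * ℓ, Reach K n h d := by
  classical
  induction m generalizing h with
  | zero => exact Or.inr ⟨{h}, by simp, by simp [Reach]⟩
  | succ m ih =>
    have hmul : (m + 1) * ℓ = m * ℓ + ℓ := Nat.succ_mul m ℓ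
    rcases hdense h hv with H | ⟨n, hn, a, g₁, g₂, ha, hg₁, hg₂, hne⟩
    · exact Or.inl (H.mono (by omega))
    refine or_iff_not_imp_left.2 fun hanchor => ?_
    have htree : ∀ g, Succ K a g → ∃ D : Finset HalfEdge, 2 ^ m ≤ D.card ∧
        ∀ d ∈ D, ∃ n ≤ m * ℓ, Reach K n g d := fun g hg => by
      have hhg : Reach K (n + 1) h g := ⟨a, ha, hg⟩
      exact (ih (hE.near_valid hv (hhg.near hK))).resolve_left fun H =>
        hanchor ((H.of_reach hK hhg).mono (by omega))
    obtain ⟨D₁, hcard₁, hD₁⟩ := htree g₁ hg₁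
    obtain ⟨D₂, hcard₂, hD₂⟩ := htree g₂ hg₂
    have hdisj : Disjoint D₁ D₂ := Finset.disjoint_left.2 fun d hd₁ hd₂ => by
      obtain ⟨n₁, hn₁, h₁⟩ := hD₁ d hd₁
      obtain ⟨n₂, hn₂, h₂⟩ := hD₂ d hd₂
      exact hanchor ((HasAnchor.of_branches_meet hK ha hg₁ hg₂ hne h₁ h₂ hn₁ hn₂).mono (by omega))
    refine ⟨D₁ ∪ D₂, by rw [Finset.card_union_of_disjoint hdisj, pow_succ]; omega, fun d hd => ?_⟩
    rcases Finset.mem_union.1 hd with hd | hd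
    · obtain ⟨s, hs, H⟩ := hD₁ d hd
      exact ⟨_, by omega, ha.trans (H.cons hg₁)⟩
    · obtain ⟨s, hs, H⟩ := hD₂ d hd
      exact ⟨_, by omega, ha.trans (H.cons hg₂)⟩

theorem exists_isSupport_empty (hE : IsIncidence E) (hv : E h h)
    (hanchor : ∀ h, E h h → HasAnchor E K r h) :
    ∃ F, h ∈ F ∧ IsSupport K ∅ F ∧ ∀ p ∈ F, Near E (r + 1) h p := by
  classical
  obtain ⟨F, hh, hF, hnear⟩ := hanchor h hv
  obtain ⟨F', hh', hF', hnear'⟩ := hanchor h.swap (hE.swap hv)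
  refine ⟨F ∪ F', by simp [hh], (hF.union hF').of_saturated ?_, fun p hp => ?_⟩
  · rintro p (rfl | rfl) -
    · exact (hF'.saturated p (by simpa using hF'.swap _ hh') (hE.swap_ne hv).symm).mono
        Finset.subset_union_right
    · exact (hF.saturated _ (hF.swap h hh) (hE.swap_ne hv)).mono Finset.subset_union_left
  · rcases Finset.mem_union.1 hp with hp | hp
    · exact (hnear p hp).succ
    · rw [Nat.add_comm]
      exact (near_one_swap E h).trans (hnear' p hp)

end Support

section Flow

variable {E E' K K' : Incidence} {r ρ : ℕ} {h g : HalfEdge} {P : Finset HalfEdge}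

/-- An orientation of finitely many edges within distance `ρ` of each other, given by the outgoing
half-edges, such that every class of joined half-edges touched, unless it is a singleton, has an
outgoing and an incoming member. -/
structure IsFlow (E K : Incidence) (ρ : ℕ) (P : Finset HalfEdge) : Prop where
  swap : ∀ p ∈ P, p.swap ∉ P
  mixed : ∀ p, p ∈ P ∨ p.swap ∈ P → ∀ q, K p q → q ≠ p →
    (∃ a, K p a ∧ a ∈ P) ∧ ∃ b, K p b ∧ b.swap ∈ P
  near : ∀ p ∈ P, ∀ p' ∈ P, Near E ρ p p'

/-- The flows through the edge of `h`. -/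
def flows (E K : Incidence) (ρ : ℕ) (h : HalfEdge) : Set (Finset HalfEdge) :=
  {P | IsFlow E K ρ P ∧ (h ∈ P ∨ h.swap ∈ P)}

theorem flows_swap (E K : Incidence) (ρ : ℕ) (h : HalfEdge) :
    flows E K ρ h.swap = flows E K ρ h :=
  Set.ext fun _ => and_congr_right' (by rw [Prod.swap_swap, or_comm])

theorem flows_nonempty (hE : IsIncidence E) (hK : IsJoining E K) (hv : E h h)
    (hanchor : ∀ h, E h h → HasAnchor E K r h) (hρ : 2 * (r + 1) ≤ ρ) :
    (flows E K ρ h).Nonempty := by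
  classical
  obtain ⟨F, hh, hF, hnear⟩ := exists_isSupport_empty hE hv hanchor
  obtain ⟨P, hPswap, hPmixed⟩ := exists_orientation hK.symm hK.trans
    (Prod.swap_swap : Function.Involutive (Prod.swap : HalfEdge → HalfEdge)) hF.swap
    fun p hp => hE.swap_ne (hE.near_valid hv (hnear p hp))
  have hmem : ∀ p, p ∈ F.filter P ∨ p.swap ∈ F.filter P → p ∈ F := fun p hp =>
    hp.elim (fun hp => (Finset.mem_filter.1 hp).1)
      fun hp => by simpa using hF.swap _ (Finset.mem_filter.1 hp).1
  refine ⟨F.filter P, ⟨fun p hp hp' => ?_, fun p hp q hpq hqp => ?_, fun p hp p' hp' => ?_⟩, ?_⟩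
  · obtain ⟨hpF, hpP⟩ := Finset.mem_filter.1 hp
    exact (hPswap p hpF).1 (Finset.mem_filter.1 hp').2 hpP
  · have hpF := hmem p hp
    rcases hF.saturated p hpF (Set.notMem_empty p) with hleaf | ⟨q', hq', hne, hKpq⟩
    · exact absurd (hleaf q hpq) hqp
    obtain ⟨⟨a, haF, hKa, ha⟩, b, hbF, hKb, hb⟩ := hPmixed p hpF q' hq' hne.symm hKpq
    exact ⟨⟨a, hKa, Finset.mem_filter.2 ⟨haF, ha⟩⟩,
      b, hKb, Finset.mem_filter.2 ⟨hF.swap b hbF, (hPswap b hbF).2 hb⟩⟩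
  · exact ((hE.near_symm (hnear p (hmem p (Or.inl hp)))).trans
      (hnear p' (hmem p' (Or.inl hp')))).mono (by omega)
  · by_cases hP : P h
    · exact Or.inl (Finset.mem_filter.2 ⟨hh, hP⟩)
    · exact Or.inr (Finset.mem_filter.2 ⟨hF.swap h hh, (hPswap h hh).2 hP⟩)

/-- The half-edges that are directed away from their node. -/
def IsOut (E K : Incidence) (ρ : ℕ) (h : HalfEdge) : Prop := h ∈ firstMem (flows E K ρ h)

theorem isOut_swap (hP : (flows E K ρ h).Nonempty) :
    IsOut E K ρ h.swap ↔ ¬ IsOut E K ρ h := by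
  rw [IsOut, flows_swap, IsOut]
  obtain ⟨hflow, hmem⟩ := firstMem_mem hP
  exact ⟨fun hs hh => hflow.swap _ hh hs, hmem.resolve_left⟩

-- The first of all the flows through the class of `h` is the first one for each of its edges there.
theorem exists_isOut (hK : IsJoining E K) (hP : (flows E K ρ h).Nonempty) (hg : K h g)
    (hne : g ≠ h) : (∃ a, K h a ∧ IsOut E K ρ a) ∧ ∃ b, K h b ∧ IsOut E K ρ b.swap := by
  have hhh : K h h := hK.trans hg (hK.symm hg)
  set 𝒲 : Set (Finset HalfEdge) := {P | ∃ p, K h p ∧ P ∈ flows E K ρ p}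
  obtain ⟨p, hp, hflow, hpP⟩ := firstMem_mem (𝒱 := 𝒲) (hP.imp fun P hP => ⟨h, hhh, hP⟩)
  obtain ⟨q, hpq, hqp⟩ : ∃ q, K p q ∧ q ≠ p := by
    by_cases hph : p = h
    · exact hph ▸ ⟨g, hg, hne⟩
    · exact ⟨h, hK.symm hp, Ne.symm hph⟩
  obtain ⟨⟨a, ha, haP⟩, b, hb, hbP⟩ := hflow.mixed p hpP q hpq hqp
  have hfirst : ∀ f, K h f → (f ∈ firstMem 𝒲 ∨ f.swap ∈ firstMem 𝒲) →
      firstMem (flows E K ρ f) = firstMem 𝒲 := fun f hf hfP =>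
    firstMem_eq_of_subset (fun P hP => ⟨f, hf, hP⟩) ⟨hflow, hfP⟩
  refine ⟨⟨a, hK.trans hp ha, ?_⟩, b, hK.trans hp hb, ?_⟩
  · rwa [IsOut, hfirst a (hK.trans hp ha) (Or.inl haP)]
  · rwa [IsOut, flows_swap, hfirst b (hK.trans hp hb) (Or.inr hbP)]

theorem Agree.isFlow_iff (A : Agree E E' r h) (hr : 2 * ρ + 1 ≤ r)
    (AK : ∀ p, Near E (ρ + 2) h p → ∀ q, K p q ↔ K' p q)
    (hP : ∀ p ∈ P, Near E (ρ + 1) h p) : IsFlow E K ρ P ↔ IsFlow E' K' ρ P := by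
  have hmixed : (∀ p, p ∈ P ∨ p.swap ∈ P → ∀ q, K p q → q ≠ p →
        (∃ a, K p a ∧ a ∈ P) ∧ ∃ b, K p b ∧ b.swap ∈ P) ↔
      ∀ p, p ∈ P ∨ p.swap ∈ P → ∀ q, K' p q → q ≠ p →
        (∃ a, K' p a ∧ a ∈ P) ∧ ∃ b, K' p b ∧ b.swap ∈ P := by
    refine forall₂_congr fun p hp => ?_
    have hnear : Near E (ρ + 2) h p :=
      hp.elim (fun hp => (hP p hp).succ) fun hp => by simpa using (hP _ hp).swap
    simp only [AK p hnear]
  have hnear : (∀ p ∈ P, ∀ p' ∈ P, Near E ρ p p') ↔ ∀ p ∈ P, ∀ p' ∈ P, Near E' ρ p p' :=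
    forall₂_congr fun p hp => forall₂_congr fun p' _ =>
      (A.of_near (hP p hp) (by omega)).near_iff p'
  exact ⟨fun H => ⟨H.swap, hmixed.1 H.mixed, hnear.1 H.near⟩,
    fun H => ⟨H.swap, hmixed.2 H.mixed, hnear.2 H.near⟩⟩

theorem Agree.isOut_iff (A : Agree E E' r h) (hr : 2 * ρ + 1 ≤ r)
    (AK : ∀ p, Near E (ρ + 2) h p → ∀ q, K p q ↔ K' p q) :
    IsOut E K ρ h ↔ IsOut E' K' ρ h := by
  suffices flows E K ρ h = flows E' K' ρ h by rw [IsOut, this, IsOut]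
  refine Set.ext fun P => and_congr_left fun hP => ?_
  obtain ⟨p, hp, hhp⟩ : ∃ p ∈ P, Near E 1 h p :=
    hP.elim (fun hP => ⟨h, hP, near_self E 1 h⟩) fun hP => ⟨_, hP, near_one_swap E h⟩
  have hiff : (∀ p' ∈ P, Near E (ρ + 1) h p') → (IsFlow E K ρ P ↔ IsFlow E' K' ρ P) :=
    A.isFlow_iff hr AK
  refine ⟨fun H => (hiff fun p' hp' => ?_).1 H, fun H => (hiff fun p' hp' => ?_).2 H⟩ <;>
    rw [Nat.add_comm]
  · exact hhp.trans (H.near p hp p' hp')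
  · exact hhp.trans (((A.of_near (t := ρ) hhp (by omega)).near_iff p').2 (H.near p hp p' hp'))

end Flow

section SignedSum

variable {α : Type*} {S : Finset α} {f : α → ℤ}

theorem abs_sum_le_card (hf : ∀ x ∈ S, |f x| ≤ 1) : |∑ x ∈ S, f x| ≤ S.card :=
  (Finset.abs_sum_le_sum_abs f S).trans (by simpa using Finset.sum_le_card_nsmul S _ 1 hf)

theorem abs_sum_add_two_le_card (hf : ∀ x ∈ S, |f x| ≤ 1) {a b : α} (ha : a ∈ S) (hb : b ∈ S)
    (hfa : f a = 1) (hfb : f b = -1) : |∑ x ∈ S, f x| + 2 ≤ S.card := by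
  classical
  have hba : b ∈ S.erase a := Finset.mem_erase.2 ⟨by rintro rfl; omega, hb⟩
  have hrest : |∑ x ∈ (S.erase a).erase b, f x| ≤ ((S.erase a).erase b).card :=
    abs_sum_le_card fun x hx => hf x (Finset.mem_of_mem_erase (Finset.mem_of_mem_erase hx))
  rw [← Finset.add_sum_erase _ _ ha, ← Finset.add_sum_erase _ _ hba, hfa, hfb,
    add_neg_cancel_left, ← Finset.card_erase_add_one ha, ← Finset.card_erase_add_one hba]
  push_cast
  linarith

/-- The sum of `f` over `S` is at most `2 * q + 2` in absolute value, and at most `2 * q + 1` if the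
number of summands is odd. -/
def IsBalanced (f : α → ℤ) (S : Finset α) (q : ℕ) : Prop :=
  |∑ x ∈ S, f x| ≤ 2 * q + 2 ∧ (Odd S.card → |∑ x ∈ S, f x| ≤ 2 * q + 1)

theorem card_filter_div_eq {r : α → ℕ} (hr : Set.BijOn r S (Finset.range S.card)) {m : ℕ}
    (hm : 0 < m) (q : ℕ) :
    (S.filter fun x => r x / m = q).card = min S.card (m * q + m) - m * q := by
  rw [← Nat.card_Ico]
  have hdiv : ∀ n, n / m = q ↔ m * q ≤ n ∧ n < m * q + m := fun n => by
    rw [Nat.div_eq_iff hm, Nat.mul_comm q m]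
    omega
  refine Finset.card_nbij r (fun x hx => ?_) (hr.injOn.mono fun x hx => ?_) fun n hn => ?_
  · obtain ⟨hxS, hx⟩ := Finset.mem_filter.1 hx
    have hlt := Finset.mem_range.1 (hr.mapsTo hxS)
    rw [Finset.mem_coe, Finset.mem_Ico, lt_min_iff]
    have := (hdiv _).1 hx
    omega
  · exact (Finset.mem_filter.1 hx).1
  · rw [Finset.mem_coe, Finset.mem_Ico, lt_min_iff] at hn
    obtain ⟨x, hx, rfl⟩ := hr.surjOn (Finset.mem_coe.2 (Finset.mem_range.2 hn.2.1))
    exact ⟨x, Finset.mem_filter.2 ⟨hx, (hdiv _).2 ⟨hn.1, hn.2.2⟩⟩, rfl⟩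

theorem isBalanced_of_groups {r : α → ℕ} (hr : Set.BijOn r S (Finset.range S.card)) {m : ℕ}
    (hm : 0 < m) (heven : Even m)
    (hf : ∀ q, IsBalanced f (S.filter fun x => r x / m = q) 0) :
    IsBalanced f S (S.card / m) := by
  set Q := S.card / m with hQ
  have hmaps : ∀ x ∈ S, r x / m ∈ Finset.range (Q + 1) := fun x hx =>
    Finset.mem_range.2 (Nat.lt_succ_of_le
      (Nat.div_le_div_right (Finset.mem_range.1 (hr.mapsTo hx)).le))
  have hfirst : |∑ q ∈ Finset.range Q, ∑ x ∈ S with r x / m = q, f x| ≤ 2 * (Q : ℤ) := by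
    refine (Finset.abs_sum_le_sum_abs _ _).trans
      ((Finset.sum_le_card_nsmul _ _ 2 fun q _ => ?_).trans_eq ?_)
    · simpa using (hf q).1
    · rw [Finset.card_range, nsmul_eq_mul, mul_comm]
  have hlast := hf Q
  have hcard : (S.filter fun x => r x / m = Q).card = S.card % m := by
    have h1 := Nat.div_add_mod S.card m
    have h2 := Nat.mod_lt S.card hm
    rw [← hQ] at h1
    rw [card_filter_div_eq hr hm, min_eq_left (by omega)]
    omega
  rw [IsBalanced, ← Finset.sum_fiberwise_of_maps_to hmaps f, Finset.sum_range_succ]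
  rw [IsBalanced, hcard, Nat.cast_zero, mul_zero, zero_add, zero_add] at hlast
  refine ⟨(abs_add_le _ _).trans (add_le_add hfirst hlast.1), fun hodd => ?_⟩
  exact (abs_add_le _ _).trans (add_le_add hfirst (hlast.2 (hodd.mod_even heven)))

end SignedSum

section Joined

variable {E E' : Incidence} {C C' : HalfEdge → Prop} {r i L β : ℕ} {h g c s : HalfEdge}

/-- `h` takes no part in the pairing of half-edges at its node, because it is left over or because
the pair is cut. -/
def IsLoose (E : Incidence) (C : HalfEdge → Prop) (h : HalfEdge) : Prop :=
  mate E h = h ∨ C h ∨ C (mate E h)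

/-- The half-edges paired with each other are joined, and so are the loose half-edges at a node of
odd degree. -/
def Joined (E : Incidence) (C : HalfEdge → Prop) (h g : HalfEdge) : Prop :=
  E h g ∧ (g = h ∨ (g = mate E h ∧ ¬ IsLoose E C h) ∨
    (IsLoose E C h ∧ IsLoose E C g ∧ ∃ s, E h s ∧ mate E s = s))

theorem isLoose_mate (hE : IsIncidence E) : IsLoose E C (mate E h) ↔ IsLoose E C h := by
  rw [IsLoose, IsLoose, hE.mate_involutive h, or_comm (a := C h), eq_comm]

theorem IsLoose.eq_mate_or_of_cut (hE : IsIncidence E) (hC : ∀ ⦃h g⦄, C h → C g → E h g → h = g)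
    (hh : IsLoose E C h) (hc : C c) (hhc : E h c) :
    mate E h = h ∨ h = c ∨ h = mate E c := by
  rcases hh with hh | hh | hh
  · exact Or.inl hh
  · exact Or.inr (Or.inl (hC hh hc hhc))
  · exact Or.inr (Or.inr (hE.mate_involutive.eq_iff.1
      (hC hh hc (hE.trans (hE.symm (hE.mate_rel (hE.left hhc))) hhc))))

theorem joined_mate (hE : IsIncidence E) (hv : E h h) (hl : ¬ IsLoose E C h) :
    Joined E C h (mate E h) :=
  ⟨hE.mate_rel hv, Or.inr (Or.inl ⟨rfl, hl⟩)⟩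

theorem isJoining_joined (hE : IsIncidence E) : IsJoining E (Joined E C) where
  symm := by
    rintro h g ⟨hhg, rfl | ⟨rfl, hl⟩ | ⟨hh, hg, s, hs, hsm⟩⟩
    · exact ⟨hhg, Or.inl rfl⟩
    · exact ⟨hE.symm hhg,
        Or.inr (Or.inl ⟨(hE.mate_involutive h).symm, fun H => hl ((isLoose_mate hE).1 H)⟩)⟩
    · exact ⟨hE.symm hhg, Or.inr (Or.inr ⟨hg, hh, s, hE.trans (hE.symm hhg) hs, hsm⟩)⟩
  trans := by
    rintro h g f ⟨hhg, hg | ⟨rfl, hl⟩ | ⟨hh, hg, s, hs, hsm⟩⟩ ⟨hgf, hf⟩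
    · subst hg
      exact ⟨hgf, hf⟩
    · refine ⟨hE.trans hhg hgf, ?_⟩
      rcases hf with rfl | ⟨rfl, -⟩ | ⟨hl', -⟩
      · exact Or.inr (Or.inl ⟨rfl, hl⟩)
      · exact Or.inl (hE.mate_involutive h)
      · exact absurd ((isLoose_mate hE).1 hl') hl
    · refine ⟨hE.trans hhg hgf, Or.inr (Or.inr ?_)⟩
      rcases hf with rfl | ⟨-, hl⟩ | ⟨-, hf, -⟩
      · exact ⟨hh, hg, s, hs, hsm⟩
      · exact absurd hg hl
      · exact ⟨hh, hf, s, hs, hsm⟩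
  le _ _ H := H.1

theorem IsLoose.leaf_or_exists_cut (hE : IsIncidence E) (hh : IsLoose E C h) :
    (∀ q, Joined E C h q → q = h) ∨
      ∃ s c, E h s ∧ mate E s = s ∧ E h c ∧ C c ∧ mate E c ≠ c := by
  refine or_iff_not_imp_right.2 fun hno => ?_
  rintro q ⟨hhq, rfl | ⟨-, hl⟩ | ⟨-, hq, s, hs, hsm⟩⟩
  · rfl
  · exact absurd hh hl
  · have hfixed : ∀ p, E h p → IsLoose E C p → mate E p = p := fun p hp hl => by
      by_contra hne
      rcases hl with hl | hl | hl
      · exact hne hl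
      · exact hno ⟨s, p, hs, hsm, hp, hl, hne⟩
      · exact hno ⟨s, mate E p, hs, hsm, hE.trans hp (hE.mate_rel (hE.right hp)), hl,
          by rw [hE.mate_involutive p]; exact Ne.symm hne⟩
    exact (hE.eq_of_mate_eq_self hhq (hfixed h (hE.left hhq) hh) (hfixed q hhq hq)).symm

theorem IsLoose.exists_joined_ne (hE : IsIncidence E) (hC : ∀ ⦃h g⦄, C h → C g → E h g → h = g)
    (hh : IsLoose E C h) (hs : E h s) (hsm : mate E s = s) (hc : E h c) (hCc : C c)
    (hcm : mate E c ≠ c) :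
    ∃ g₁ g₂, Joined E C h g₁ ∧ Joined E C h g₂ ∧ g₁ ≠ h ∧ g₂ ≠ h ∧ g₁ ≠ g₂ := by
  have hjoin : ∀ q, E h q → IsLoose E C q → Joined E C h q := fun q h1 h2 =>
    ⟨h1, Or.inr (Or.inr ⟨hh, h2, s, hs, hsm⟩)⟩
  have hjs := hjoin s hs (Or.inl hsm)
  have hjc := hjoin c hc (Or.inr (Or.inl hCc))
  have hjm := hjoin (mate E c) (hE.trans hc (hE.mate_rel (hE.right hc)))
    (Or.inr (Or.inr (by rwa [hE.mate_involutive c])))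
  have hsc : s ≠ c := by
    rintro rfl
    exact hcm hsm
  have hsm' : s ≠ mate E c := fun H => hsc (by rw [← hE.mate_involutive c, ← H, hsm])
  rcases hh.eq_mate_or_of_cut hE hC hCc hc with hhm | rfl | rfl
  · obtain rfl := hE.eq_of_mate_eq_self hs hhm hsm
    exact ⟨c, mate E c, hjc, hjm, hsc.symm, hsm'.symm, hcm.symm⟩
  · exact ⟨s, mate E h, hjs, hjm, hsc, hcm, hsm'⟩
  · exact ⟨s, c, hjs, hjc, hsm', hcm.symm, hsc⟩

theorem succ_fwd (hE : IsIncidence E) (hv : E h h) (hl : ¬ IsLoose E C (fwd E h)) :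
    Succ (Joined E C) h (fwd E h) := by
  have hl' : ¬ IsLoose E C h.swap := fun H => hl ((isLoose_mate hE).2 H)
  exact ⟨joined_mate hE (hE.swap hv) hl', fun H => hl' (Or.inl H)⟩

theorem reach_iterate_fwd (hE : IsIncidence E) (hv : E h h) (i : ℕ)
    (hl : ∀ j < i, ¬ IsLoose E C ((fwd E)^[j + 1] h)) :
    Reach (Joined E C) i h ((fwd E)^[i] h) := by
  induction i with
  | zero => rfl
  | succ i ih =>
    refine ⟨_, ih fun j hj => hl j (by omega), ?_⟩
    have hli := hl i (by omega)
    rw [Function.iterate_succ_apply'] at hli ⊢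
    exact succ_fwd hE (hE.iterate_fwd_valid hv i) hli

theorem hasAnchor_or_branches_of_isLoose (hE : IsIncidence E)
    (hC : ∀ ⦃h g⦄, C h → C g → E h g → h = g) (hv : E h h)
    (hl : ∀ j < i, ¬ IsLoose E C ((fwd E)^[j + 1] h)) (hli : IsLoose E C ((fwd E)^[i + 1] h)) :
    HasAnchor E (Joined E C) (2 * i + 1) h ∨ Branches (Joined E C) (i + 1) h := by
  have hreach := reach_iterate_fwd hE hv i hl
  have hloose : IsLoose E C ((fwd E)^[i] h).swap := by
    rw [Function.iterate_succ_apply'] at hli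
    exact (isLoose_mate hE).1 hli
  rcases hloose.leaf_or_exists_cut hE with hleaf | ⟨s, c, hs, hsm, hc, hCc, hcm⟩
  · exact Or.inl (((HasAnchor.of_leaf hleaf).of_reach (isJoining_joined hE) hreach).mono
      (by omega))
  · obtain ⟨g₁, g₂, h₁, h₂, hne₁, hne₂, hne⟩ :=
      hloose.exists_joined_ne hE hC hs hsm hc hCc hcm
    exact Or.inr ⟨i, by omega, _, g₁, g₂, hreach, ⟨h₁, hne₁⟩, ⟨h₂, hne₂⟩, hne⟩

theorem hasAnchor_of_cycle (hE : IsIncidence E) (hv : E h h)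
    (hl : ∀ j ≤ i, ¬ IsLoose E C ((fwd E)^[j + 1] h)) (hi : (fwd E)^[i + 1] h = h) :
    HasAnchor E (Joined E C) (4 * i + 3) h := by
  have hreach : Reach (Joined E C) i h ((fwd E)^[i] h) :=
    reach_iterate_fwd hE hv i fun j hj => hl j hj.le
  have hsucc : Succ (Joined E C) ((fwd E)^[i] h) h := by
    have hli := hl i le_rfl
    rw [Function.iterate_succ_apply'] at hi hli
    simpa only [hi] using succ_fwd hE (hE.iterate_fwd_valid hv i) hli
  exact HasAnchor.of_cycle (isJoining_joined hE) hreach hsucc hreach (by omega)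

theorem hasAnchor_or_branches (hE : IsIncidence E) (hC : ∀ ⦃h g⦄, C h → C g → E h g → h = g)
    (hL : 0 < L) (hcode : ∀ h, E h h → code h < 2 ^ β)
    (hcut : ∀ x, E x x → IsStart E L β x → ∃ q ∈ window E L x, C q) (hv : E h h) :
    HasAnchor E (Joined E C) (2 * (3 * L + 1) + 1) h ∨ Branches (Joined E C) (3 * L + 1) h := by
  classical
  by_cases hloose : ∃ i, i ≤ 3 * L ∧ IsLoose E C ((fwd E)^[i + 1] h)
  · obtain ⟨hi, hli⟩ := Nat.find_spec hloose
    refine (hasAnchor_or_branches_of_isLoose hE hC hv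
      (fun j hj H => Nat.find_min hloose hj ⟨by omega, H⟩) hli).imp
      (fun H => H.mono (by omega)) ?_
    rintro ⟨n, hn, H⟩
    exact ⟨n, by omega, H⟩
  push Not at hloose
  rcases exists_end_or_isStart_or_cycle hE hL hcode (hE.iterate_fwd_valid hv 1) with
    ⟨i, hi, H⟩ | ⟨i, hi, H⟩ | ⟨p, hp₁, hp, H⟩
  · exact absurd (Or.inl H) (hloose i hi)
  · obtain ⟨q, hq, hCq⟩ := hcut _ (hE.iterate_fwd_valid (hE.iterate_fwd_valid hv 1) i) H
    obtain ⟨j, hj, rfl⟩ := mem_window.1 hq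
    rw [← Function.iterate_add_apply, ← Function.iterate_add_apply] at hCq
    exact absurd (Or.inr (Or.inl hCq)) (hloose (j + i) (by omega))
  · obtain ⟨i, rfl⟩ : ∃ i, p = i + 1 := ⟨p - 1, by omega⟩
    have hcycle : (fwd E)^[i + 1] h = h := hE.bwd_fwd.injective <| by
      rw [← Function.iterate_succ_apply' (fwd E)]
      exact H
    exact Or.inl ((hasAnchor_of_cycle hE hv (fun j hj => hloose j (by omega)) hcycle).mono
      (by omega))

section Balance

variable {f : HalfEdge → ℤ} {S : Finset HalfEdge}

theorem sum_not_isLoose_eq_zero [DecidablePred (IsLoose E C)] (hE : IsIncidence E)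
    (hf : ∀ ⦃h g⦄, Joined E C h g → g ≠ h →
      (∃ a, Joined E C h a ∧ f a = 1) ∧ ∃ b, Joined E C h b ∧ f b = -1)
    (hS : ∀ g, g ∈ S ↔ E h g) : ∑ g ∈ S with ¬ IsLoose E C g, f g = 0 := by
  refine Finset.sum_involution (fun g _ => mate E g) ?_ ?_ ?_ fun g _ => hE.mate_involutive g <;>
    intro g hg <;> obtain ⟨hgS, hl⟩ := Finset.mem_filter.1 hg
  · have hpair : ∀ q, Joined E C g q → q = g ∨ q = mate E g := by
      rintro q ⟨-, hq | ⟨hq, -⟩ | ⟨hl', -⟩⟩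
      · exact Or.inl hq
      · exact Or.inr hq
      · exact absurd hl' hl
    obtain ⟨⟨a, ha, hfa⟩, b, hb, hfb⟩ :=
      hf (joined_mate hE (hE.right ((hS g).1 hgS)) hl) fun H => hl (Or.inl H)
    rcases hpair a ha with rfl | rfl <;> rcases hpair b hb with rfl | rfl <;> omega
  · exact fun _ H => hl (Or.inl H)
  · have hgm := hE.mate_rel (hE.right ((hS g).1 hgS))
    exact Finset.mem_filter.2 ⟨(hS _).2 (hE.trans ((hS g).1 hgS) hgm),
      fun H => hl ((isLoose_mate hE).1 H)⟩

theorem card_isLoose_le [DecidablePred (IsLoose E C)] (hE : IsIncidence E)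
    (hC : ∀ ⦃h g⦄, C h → C g → E h g → h = g) (hS : ∀ g, g ∈ S ↔ E h g) :
    (S.filter (IsLoose E C)).card ≤ (S.filter fun g => mate E g = g).card + 2 := by
  by_cases hcut : ∃ c ∈ S, C c
  · obtain ⟨c, hc, hCc⟩ := hcut
    have hsub : S.filter (IsLoose E C) ⊆ (S.filter fun g => mate E g = g) ∪ {c, mate E c} := by
      intro g hg
      obtain ⟨hgS, hl⟩ := Finset.mem_filter.1 hg
      have hgc : E g c := hE.trans (hE.symm ((hS g).1 hgS)) ((hS c).1 hc)
      simpa [hgS, or_assoc, or_comm] using hl.eq_mate_or_of_cut hE hC hCc hgc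
    exact (Finset.card_le_card hsub).trans ((Finset.card_union_le _ _).trans
      (Nat.add_le_add_left Finset.card_le_two _))
  · refine (Finset.card_le_card fun g hg => ?_).trans (Nat.le_add_right _ 2)
    obtain ⟨hgS, hl⟩ := Finset.mem_filter.1 hg
    have hgm : mate E g ∈ S :=
      (hS _).2 (hE.trans ((hS g).1 hgS) (hE.mate_rel (hE.right ((hS g).1 hgS))))
    rcases hl with hl | hl | hl
    · exact Finset.mem_filter.2 ⟨hgS, hl⟩
    · exact absurd ⟨g, hgS, hl⟩ hcut
    · exact absurd ⟨_, hgm, hl⟩ hcut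

theorem card_mate_eq_self_le_one (hE : IsIncidence E) (hS : ∀ g, g ∈ S ↔ E h g) :
    (S.filter fun g => mate E g = g).card ≤ 1 := by
  refine Finset.card_le_one.2 fun a ha b hb => ?_
  simp only [Finset.mem_filter, hS] at ha hb
  exact hE.eq_of_mate_eq_self (hE.trans (hE.symm ha.1) hb.1) ha.2 hb.2

theorem abs_sum_isLoose_le_one [DecidablePred (IsLoose E C)] (hE : IsIncidence E)
    (hC : ∀ ⦃h g⦄, C h → C g → E h g → h = g) (hf₁ : ∀ g, |f g| ≤ 1)
    (hf : ∀ ⦃h g⦄, Joined E C h g → g ≠ h →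
      (∃ a, Joined E C h a ∧ f a = 1) ∧ ∃ b, Joined E C h b ∧ f b = -1)
    (hS : ∀ g, g ∈ S ↔ E h g) (hs : s ∈ S) (hsm : mate E s = s) :
    |∑ g ∈ S with IsLoose E C g, f g| ≤ 1 := by
  have hrel : ∀ a ∈ S, ∀ b ∈ S, E a b := fun a ha b hb =>
    hE.trans (hE.symm ((hS a).1 ha)) ((hS b).1 hb)
  rcases le_or_gt (S.filter (IsLoose E C)).card 1 with hcard | hcard
  · exact (abs_sum_le_card fun g _ => hf₁ g).trans (by exact_mod_cast hcard)
  obtain ⟨x, hx, y, hy, hxy⟩ := Finset.one_lt_card.1 hcard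
  obtain ⟨hxS, hxl⟩ := Finset.mem_filter.1 hx
  obtain ⟨hyS, hyl⟩ := Finset.mem_filter.1 hy
  have hmem : ∀ q, Joined E C x q → q ∈ S.filter (IsLoose E C) := by
    rintro q ⟨hxq, hq⟩
    refine Finset.mem_filter.2 ⟨(hS q).2 (hE.trans ((hS x).1 hxS) hxq), ?_⟩
    rcases hq with rfl | ⟨-, hl⟩ | ⟨-, hl, -⟩
    · exact hxl
    · exact absurd hxl hl
    · exact hl
  obtain ⟨⟨a, ha, hfa⟩, b, hb, hfb⟩ := hf ⟨hrel x hxS y hyS,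
    Or.inr (Or.inr ⟨hxl, hyl, s, hrel x hxS s hs, hsm⟩)⟩ hxy.symm
  have hsum : |∑ g ∈ S with IsLoose E C g, f g| + 2 ≤ (S.filter (IsLoose E C)).card :=
    abs_sum_add_two_le_card (fun g _ => hf₁ g) (hmem a ha) (hmem b hb) hfa hfb
  have hloose := card_isLoose_le (C := C) hE hC hS
  have hfixed := card_mate_eq_self_le_one hE hS
  omega

theorem isBalanced_node (hE : IsIncidence E) (hC : ∀ ⦃h g⦄, C h → C g → E h g → h = g)
    (hf₁ : ∀ g, |f g| ≤ 1) (hf : ∀ ⦃h g⦄, Joined E C h g → g ≠ h →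
      (∃ a, Joined E C h a ∧ f a = 1) ∧ ∃ b, Joined E C h b ∧ f b = -1)
    (hS : ∀ g, g ∈ S ↔ E h g) :
    IsBalanced f S 0 := by
  classical
  rw [IsBalanced, Nat.cast_zero, mul_zero, zero_add, zero_add,
    ← Finset.sum_filter_add_sum_filter_not S (IsLoose E C) f, sum_not_isLoose_eq_zero hE hf hS,
    add_zero]
  by_cases hfixed : ∃ s ∈ S, mate E s = s
  · obtain ⟨s, hs, hsm⟩ := hfixed
    have hle := abs_sum_isLoose_le_one hE hC hf₁ hf hS hs hsm
    exact ⟨by omega, fun _ => hle⟩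
  push Not at hfixed
  have hcard := card_isLoose_le (C := C) hE hC hS
  rw [Finset.filter_eq_empty_iff.2 fun {g} hg => hfixed g hg, Finset.card_empty, zero_add] at hcard
  have heven : Even S.card := even_card_of_involutive hE.mate_involutive
    (fun g hg => (hS _).2 (hE.trans ((hS g).1 hg) (hE.mate_rel (hE.right ((hS g).1 hg))))) hfixed
  exact ⟨(abs_sum_le_card fun g _ => hf₁ g).trans (by exact_mod_cast hcard),
    fun hodd => absurd heven (Nat.not_even_iff_odd.2 hodd)⟩

end Balance

theorem Agree.isLoose_iff (A : Agree E E' r h) (hh : C h ↔ C' h)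
    (hm : C (mate E h) ↔ C' (mate E h)) : IsLoose E C h ↔ IsLoose E' C' h := by
  rw [IsLoose, IsLoose, ← A.mate_eq, hh, hm]

theorem Agree.joined_iff (A : Agree E E' r h) (hr : 1 ≤ r)
    (hC : ∀ g, Near E 2 h g → (C g ↔ C' g)) (g : HalfEdge) :
    Joined E C h g ↔ Joined E' C' h g := by
  have hA : ∀ g, Near E 1 h g → Agree E E' 0 g := fun g hg => A.of_near hg (by omega)
  have hloose : ∀ g, Near E 1 h g → (IsLoose E C g ↔ IsLoose E' C' g) := fun g hg =>
    (hA g hg).isLoose_iff (hC g hg.succ) (hC _ (hg.trans (near_mate E g)))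
  have hodd : (∃ s, E h s ∧ mate E s = s) ↔ ∃ s, E' h s ∧ mate E' s = s := by
    refine exists_congr fun s => ?_
    rw [← A.rel_iff s]
    exact and_congr_right fun hs => by rw [(hA s (near_one_of_rel hs)).mate_eq]
  rw [Joined, Joined, ← A.rel_iff g]
  refine and_congr_right fun hg => ?_
  rw [hloose h (near_self E 1 h), hloose g (near_one_of_rel hg), A.mate_eq, hodd]

end Joined

section Splitting

variable {E E' : Incidence} {r L β : ℕ} {h : HalfEdge}

/-- The value `1` on `P` and `-1` elsewhere. -/
noncomputable def sign {α : Type*} (P : α → Prop) (x : α) : ℤ :=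
  open Classical in if P x then 1 else -1

/-- The diameter of the flows that determine a splitting. -/
def flowRadius (L β : ℕ) : ℕ := 4 * (β * (3 * L + 1)) + 4 * (3 * L + 1) + 4

/-- The half-edges directed away from their node when the half-edges of the cut pairs are joined
with the left-over ones. -/
def Splitting (E : Incidence) (L β : ℕ) : HalfEdge → Prop :=
  IsOut E (Joined E (IsCut E L β)) (flowRadius L β)

theorem IsBounded.hasAnchor (hE : IsBounded E L β) (hv : E h h) :
    HasAnchor E (Joined E (IsCut E L β)) (2 * (β * (3 * L + 1)) + 2 * (3 * L + 1) + 1) h := by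
  have hK := isJoining_joined (C := IsCut E L β) hE.toIsIncidence
  refine (exists_hasAnchor_or_two_pow_le_card hE.toIsIncidence hK (fun h hv =>
    hasAnchor_or_branches hE.toIsIncidence (fun _ _ => IsCut.eq hE.toIsIncidence)
      (hE.length_pos hv) hE.code_lt (fun x => hE.exists_isCut) hv) β hv).resolve_right ?_
  rintro ⟨D, hcard, hD⟩
  have hsub : (D : Set HalfEdge) ⊆ {h | E h h} := fun d hd => by
    obtain ⟨n, -, hn⟩ := hD d hd
    exact hE.near_valid hv (hn.near hK)
  have hle := Set.ncard_le_ncard hsub hE.finite_valid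
  rw [Set.ncard_coe_finset] at hle
  have hlt := hE.ncard_valid_lt
  omega

theorem IsBounded.flows_nonempty (hE : IsBounded E L β) (hv : E h h) :
    (flows E (Joined E (IsCut E L β)) (flowRadius L β) h).Nonempty :=
  DegreeSplitting.flows_nonempty hE.toIsIncidence (isJoining_joined hE.toIsIncidence) hv
    (fun _ => hE.hasAnchor) (by rw [flowRadius]; omega)

theorem IsBounded.splitting_swap (hE : IsBounded E L β) (hv : E h h) :
    Splitting E L β h.swap ↔ ¬ Splitting E L β h :=
  isOut_swap (hE.flows_nonempty hv)

theorem IsBounded.isBalanced_splitting (hE : IsBounded E L β) {S : Finset HalfEdge}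
    (hS : ∀ g, g ∈ S ↔ E h g) : IsBalanced (sign (Splitting E L β)) S 0 := by
  refine isBalanced_node (C := IsCut E L β) hE.toIsIncidence
    (fun _ _ => IsCut.eq hE.toIsIncidence) (fun g => ?_) (fun h g hg hne => ?_) hS
  · rw [sign]
    split_ifs <;> norm_num
  · have hK := isJoining_joined (C := IsCut E L β) hE.toIsIncidence
    obtain ⟨⟨a, ha, hPa⟩, b, hb, hPb⟩ :=
      exists_isOut hK (hE.flows_nonempty (hE.left (hK.le hg))) hg hne
    exact ⟨⟨a, ha, if_pos hPa⟩, b, hb,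
      if_neg ((hE.splitting_swap (hE.right (hK.le hb))).1 hPb)⟩

theorem Agree.splitting_iff (A : Agree E E' r h)
    (hr : 2 * flowRadius L β + 2 * cutRadius L β + 6 * (L * β) + 4 * L + 6 ≤ r) :
    Splitting E L β h ↔ Splitting E' L β h :=
  A.isOut_iff (by omega) fun _ hp =>
    (A.of_near (t := 2 * cutRadius L β + 6 * (L * β) + 4 * L + 4) hp (by omega)).joined_iff
      (by omega) fun _ hg =>
        (A.of_near (hp.trans hg) (by omega)).isCut_iff le_rfl

end Splitting

section Groups

variable {κ : Type*} {side : HalfEdge → κ} {k β : ℕ} {D D' : Set HalfEdge} {h g : HalfEdge}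

/-- The position of `h` among the half-edges at the same node and on the same side. -/
noncomputable def rank (side : HalfEdge → κ) (D : Set HalfEdge) (h : HalfEdge) : ℕ :=
  open Classical in Nat.count (fun c => (h.1, c) ∈ D ∧ side (h.1, c) = side h) h.2

/-- The half-edges of `D` with every node split into its sides, and every side into groups of
`2 * k` half-edges and one smaller group. -/
def groups (side : HalfEdge → κ) (k : ℕ) (D : Set HalfEdge) : Incidence := fun h g =>
  h ∈ D ∧ g ∈ D ∧ g.1 = h.1 ∧ side g = side h ∧
    rank side D g / (2 * k) = rank side D h / (2 * k)

theorem groups_self_iff : groups side k D h h ↔ h ∈ D :=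
  ⟨fun H => H.1, fun H => ⟨H, H, rfl, rfl, rfl⟩⟩

theorem groups_congr (hrow : ∀ c, (h.1, c) ∈ D ↔ (h.1, c) ∈ D') :
    groups side k D h g ↔ groups side k D' h g := by
  have hrank : ∀ f : HalfEdge, f.1 = h.1 → rank side D f = rank side D' f := fun f hf => by
    rw [rank, rank]
    congr! 3 with c
    rw [hf, hrow]
  by_cases hg : g.1 = h.1
  · have hgD : g ∈ D ↔ g ∈ D' := by simpa only [← hg] using hrow g.2
    rw [groups, groups, hrow h.2, hgD, hrank h rfl, hrank g hg]
  · simp only [groups, hg, false_and, and_false]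

theorem bijOn_rank {S : Finset HalfEdge} {a : ℕ} {b : κ}
    (hS : ∀ h, h ∈ S ↔ h ∈ D ∧ h.1 = a ∧ side h = b) :
    Set.BijOn (rank side D) S (Finset.range S.card) := by
  classical
  set p : ℕ → Prop := fun c => (a, c) ∈ D ∧ side (a, c) = b with hp
  have hrank : ∀ h ∈ S, p h.2 ∧ rank side D h = Nat.count p h.2 := by
    rintro ⟨a', c⟩ hh
    obtain ⟨hD, rfl, rfl⟩ := (hS _).1 hh
    exact ⟨⟨hD, rfl⟩, by simp only [rank, hp]⟩
  have hsnd : Set.InjOn Prod.snd (S : Set HalfEdge) := fun x hx y hy hxy =>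
    Prod.ext (((hS x).1 hx).2.1.trans ((hS y).1 hy).2.1.symm) hxy
  have hset : {c | p c} = (S.image Prod.snd : Finset ℕ) := by
    ext c
    simp only [hp, Set.mem_ofPred_eq, Finset.coe_image, Set.mem_image, Finset.mem_coe, hS]
    refine ⟨fun H => ⟨(a, c), ⟨H.1, rfl, H.2⟩, rfl⟩, ?_⟩
    rintro ⟨⟨_, c⟩, ⟨hD, rfl, hb⟩, rfl⟩
    exact ⟨hD, hb⟩
  have hfin : {c | p c}.Finite := hset ▸ Finset.finite_toSet _
  have hcard : hfin.toFinset.card = S.card := by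
    rw [← Finset.card_image_of_injOn hsnd]
    congr 1
    exact Finset.coe_injective (by rw [Set.Finite.coe_toFinset, hset])
  have hmaps : Set.MapsTo (rank side D) S (Finset.range S.card) := fun h hh => by
    rw [(hrank h hh).2, ← hcard]
    exact Finset.mem_coe.2 (Finset.mem_range.2 (Nat.count_lt_card hfin (hrank h hh).1))
  have hinj : Set.InjOn (rank side D) S := fun h hh g hg H => hsnd hh hg
    (Nat.count_injective (hrank h hh).1 (hrank g hg).1
      ((hrank h hh).2.symm.trans (H.trans (hrank g hg).2)))
  exact ⟨hmaps, hinj, Finset.surjOn_of_injOn_of_card_le _ hmaps hinj (by simp)⟩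

theorem ncard_node_groups_le (hk : 0 < k) (hfin : D.Finite) (h : HalfEdge) :
    (node (groups side k D) h).ncard ≤ 2 * k := by
  classical
  have hSfin : {g | g ∈ D ∧ g.1 = h.1 ∧ side g = side h}.Finite := hfin.subset fun g hg => hg.1
  set S := hSfin.toFinset
  have hsub : node (groups side k D) h ⊆
      (S.filter fun g => rank side D g / (2 * k) = rank side D h / (2 * k) : Finset HalfEdge) :=
    fun g ⟨_, hg, h₁, hs, hr⟩ => by simp [S, hg, h₁, hs, hr]
  refine (Set.ncard_le_ncard hsub (Finset.finite_toSet _)).trans ?_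
  rw [Set.ncard_coe_finset, card_filter_div_eq (bijOn_rank fun g => hSfin.mem_toFinset) (by omega)]
  omega

theorem isBounded_groups (hk : 0 < k) (hfin : D.Finite) (hswap : ∀ h ∈ D, h.swap ∈ D)
    (hne : ∀ h ∈ D, h.swap ≠ h) (hcode : ∀ h ∈ D, code h < 2 ^ β) :
    IsBounded (groups side k D) (4 * k) β where
  symm := fun ⟨h₁, h₂, h₃, h₄, h₅⟩ => ⟨h₂, h₁, h₃.symm, h₄.symm, h₅.symm⟩
  trans := fun ⟨h₁, _, h₃, h₄, h₅⟩ ⟨_, g₂, g₃, g₄, g₅⟩ =>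
    ⟨h₁, g₂, g₃.trans h₃, g₄.trans h₄, g₅.trans h₅⟩
  swap := fun H => groups_self_iff.2 (hswap _ H.1)
  swap_ne := fun H => hne _ H.1
  finite := fun _ => hfin.subset fun _ H => H.2.1
  two_mul_ncard_node_le h := by
    have := ncard_node_groups_le (side := side) hk hfin h
    omega
  code_lt h hh := hcode h hh.1

theorem isBalanced_side (hk : 0 < k) {f : HalfEdge → ℤ}
    (hf : ∀ (h : HalfEdge) (T : Finset HalfEdge), (∀ g, g ∈ T ↔ groups side k D h g) →
      IsBalanced f T 0) {S : Finset HalfEdge} {a : ℕ} {b : κ}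
    (hS : ∀ h, h ∈ S ↔ h ∈ D ∧ h.1 = a ∧ side h = b) : IsBalanced f S (S.card / (2 * k)) := by
  refine isBalanced_of_groups (bijOn_rank hS) (by omega) (even_two_mul k) fun q => ?_
  rcases (S.filter fun h => rank side D h / (2 * k) = q).eq_empty_or_nonempty with hT | ⟨h, hh⟩
  · rw [hT]
    exact ⟨by simp, by simp⟩
  · refine hf h _ fun g => ?_
    rw [Finset.mem_filter, hS] at hh ⊢
    obtain ⟨⟨hD, rfl, rfl⟩, rfl⟩ := hh
    exact ⟨fun ⟨⟨hg, h₁, h₂⟩, hr⟩ => ⟨hD, hg, h₁, h₂, hr⟩,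
      fun ⟨_, hg, h₁, h₂, hr⟩ => ⟨⟨hg, h₁, h₂⟩, hr⟩⟩

end Groups

section Flooding

/-- What a node knows: the number of nodes, its identifier, the identifiers of its neighbors by
ports, and some half-edges of the network. -/
structure Knowledge where
  size : ℕ
  ident : ℕ
  neighbor : ℕ → ℕ
  halfEdges : Set HalfEdge

/-- All nodes repeatedly tell their neighbors what they know, and finally compute their labels from
the half-edges they know. -/
def flooding {Out : Type} (T : ℕ → ℕ) (F : ℕ → Set HalfEdge → HalfEdge → Out) :
    LocalAlgorithm Out where
  State := Knowledge
  Msg := ℕ × Set HalfEdge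
  init n i _ := ⟨n, i, fun _ => 0, ∅⟩
  send _ s _ := (s.ident, s.halfEdges)
  step d s m := ⟨s.size, s.ident, fun j => if h : j < d then (m ⟨j, h⟩).1 else 0,
    s.halfEdges ∪ {h | ∃ i, h = (s.ident, (m i).1)} ∪ {h | ∃ i, h ∈ (m i).2}⟩
  rounds := T
  output _ s p := F s.size s.halfEdges (s.ident, s.neighbor p)

variable {Out : Type} {V : Type*} [Fintype V] {G : SimpleGraph V} [DecidableRel G.Adj]
  {T : ℕ → ℕ} {F : ℕ → Set HalfEdge → HalfEdge → Out} (N : Network G) {r t : ℕ} {v w : V}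

/-- The half-edges of a network: the edge `vw` at its end `v` is the pair of the identifiers of `v`
and `w`. -/
def halfEdges (N : Network G) : Set HalfEdge :=
  {h | ∃ v w, G.Adj v w ∧ h = (N.ident v, N.ident w)}

/-- What a node knows after `t` rounds. -/
def known (T : ℕ → ℕ) (F : ℕ → Set HalfEdge → HalfEdge → Out) (N : Network G) (t : ℕ) (v : V) :
    Knowledge :=
  (flooding T F).stateAfter N t v

theorem mk_mem_halfEdges : (N.ident v, N.ident w) ∈ halfEdges N ↔ G.Adj v w := by
  refine ⟨?_, fun h => ⟨v, w, h, rfl⟩⟩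
  rintro ⟨v', w', h, H⟩
  obtain ⟨hv, hw⟩ := Prod.mk.inj H
  rwa [N.ident_injective hv, N.ident_injective hw]

theorem finite_halfEdges : (halfEdges N).Finite := by
  refine (Set.finite_range fun p : V × V => (N.ident p.1, N.ident p.2)).subset ?_
  rintro h ⟨v, w, -, rfl⟩
  exact ⟨(v, w), rfl⟩

theorem known_ident : ∀ (t : ℕ) (v : V), (known T F N t v).ident = N.ident v
  | 0, _ => rfl
  | t + 1, v => known_ident t v

theorem known_size : ∀ (t : ℕ) (v : V), (known T F N t v).size = Fintype.card V
  | 0, _ => rfl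
  | t + 1, v => known_size t v

theorem known_neighbor (t : ℕ) (v : V) (p : Fin (G.degree v)) :
    (known T F N (t + 1) v).neighbor p = N.ident (N.port v p : V) :=
  (dif_pos p.2).trans (known_ident N t _)

theorem known_halfEdges_succ (t : ℕ) (v : V) : (known T F N (t + 1) v).halfEdges =
    (known T F N t v).halfEdges ∪
      {h | ∃ i, h = ((known T F N t v).ident, (known T F N t (N.port v i : V)).ident)} ∪
      {h | ∃ i, h ∈ (known T F N t (N.port v i : V)).halfEdges} := rfl

theorem known_halfEdges_subset (t : ℕ) (v : V) :
    (known T F N t v).halfEdges ⊆ halfEdges N := by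
  induction t generalizing v with
  | zero => exact Set.empty_subset _
  | succ t ih =>
    rw [known_halfEdges_succ]
    refine Set.union_subset (Set.union_subset (ih v) ?_) ?_
    · rintro h ⟨i, rfl⟩
      rw [known_ident, known_ident]
      exact ⟨v, _, (N.port v i).2, rfl⟩
    · rintro h ⟨i, hi⟩
      exact ih _ hi

theorem mk_mem_known_halfEdges {u : V} (p : G.Walk v u) (hw : G.Adj u w) (ht : p.length < t) :
    (N.ident u, N.ident w) ∈ (known T F N t v).halfEdges := by
  obtain ⟨t, rfl⟩ : ∃ s, t = s + 1 := ⟨t - 1, by omega⟩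
  rw [known_halfEdges_succ]
  induction p generalizing t with
  | nil =>
    refine Or.inl (Or.inr ⟨N.portTo hw, ?_⟩)
    rw [known_ident, known_ident, Network.portTo, Equiv.apply_symm_apply]
  | cons hadj p ih =>
    rw [SimpleGraph.Walk.length_cons] at ht
    obtain ⟨t, rfl⟩ : ∃ s, t = s + 1 := ⟨t - 1, by omega⟩
    refine Or.inr ⟨N.portTo hadj, ?_⟩
    rw [Network.portTo, Equiv.apply_symm_apply]
    exact ih hw t (by omega)

theorem exists_walk_of_near {κ : Type*} {side : HalfEdge → κ} {k : ℕ} (hvw : G.Adj v w)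
    {g : HalfEdge} (H : Near (groups side k (halfEdges N)) r (N.ident v, N.ident w) g) :
    ∃ u x, G.Adj u x ∧ g = (N.ident u, N.ident x) ∧ ∃ p : G.Walk v u, p.length ≤ r := by
  induction r generalizing g with
  | zero =>
    cases H
    exact ⟨v, w, hvw, rfl, SimpleGraph.Walk.nil, le_rfl⟩
  | succ r ih =>
    obtain ⟨f, hf, H⟩ := H
    obtain ⟨u, x, hux, rfl, p, hp⟩ := ih hf
    rcases H with rfl | rfl | H
    · exact ⟨u, x, hux, rfl, p, by omega⟩
    · exact ⟨x, u, hux.symm, rfl, p.concat hux, by rw [SimpleGraph.Walk.length_concat]; omega⟩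
    · obtain ⟨-, ⟨u', y, huy, rfl⟩, hu, -⟩ := H
      obtain rfl := N.ident_injective hu
      exact ⟨u', y, huy, rfl, p, by omega⟩

theorem agree_known {κ : Type*} (side : HalfEdge → κ) (k : ℕ) (hvw : G.Adj v w) (hrt : r < t) :
    Agree (groups side k (halfEdges N)) (groups side k (known T F N t v).halfEdges) r
      (N.ident v, N.ident w) := by
  intro g hg f
  obtain ⟨u, x, -, rfl, p, hp⟩ := exists_walk_of_near N hvw hg
  refine groups_congr fun c => ⟨?_, fun H => known_halfEdges_subset N t v H⟩
  rintro ⟨u', y, huy, H⟩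
  obtain ⟨hu, rfl⟩ := Prod.mk.inj H
  obtain rfl := N.ident_injective hu
  exact mk_mem_known_halfEdges N p huy (by omega)

theorem flooding_label (hvw : G.Adj v w) (hT : 0 < T (Fintype.card V)) :
    (flooding T F).label N hvw = F (Fintype.card V) (known T F N (T (Fintype.card V)) v).halfEdges
      (N.ident v, N.ident w) := by
  have hneighbor : (known T F N (T (Fintype.card V)) v).neighbor (N.portTo hvw) = N.ident w := by
    rw [← Nat.succ_pred_eq_of_pos hT, known_neighbor, Network.portTo, Equiv.apply_symm_apply]
  calc (flooding T F).label N hvw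
      = F (known T F N (T (Fintype.card V)) v).size
          (known T F N (T (Fintype.card V)) v).halfEdges
          ((known T F N (T (Fintype.card V)) v).ident,
            (known T F N (T (Fintype.card V)) v).neighbor (N.portTo hvw)) := rfl
    _ = _ := by rw [known_size, known_ident, hneighbor]

end Flooding

section Parameters

variable {c n : ℕ} {ε : ℝ}

/-- A number of bits that suffices for the codes of half-edges with identifiers up to `n ^ c`. -/
def bits (c n : ℕ) : ℕ := 2 * (c * (Nat.log 2 n + 1) + 1)

theorem code_lt_two_pow_bits {h : HalfEdge} (h₁ : h.1 ≤ n ^ c) (h₂ : h.2 ≤ n ^ c) :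
    code h < 2 ^ bits c n := by
  have hpow : n ^ c ≤ 2 ^ (c * (Nat.log 2 n + 1)) := by
    rw [mul_comm, pow_mul]
    exact Nat.pow_le_pow_left (Nat.lt_pow_succ_log_self one_lt_two n).le c
  have hmax : max h.1 h.2 + 1 ≤ 2 ^ (c * (Nat.log 2 n + 1) + 1) := by
    have := (max_le h₁ h₂).trans hpow
    have := Nat.one_le_two_pow (n := c * (Nat.log 2 n + 1))
    rw [pow_succ]
    omega
  calc code h < (max h.1 h.2 + 1) ^ 2 := Nat.pair_lt_max_add_one_sq _ _
    _ ≤ (2 ^ (c * (Nat.log 2 n + 1) + 1)) ^ 2 := Nat.pow_le_pow_left hmax 2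
    _ = 2 ^ bits c n := by rw [← pow_mul, mul_comm, bits]

theorem bits_pos (c n : ℕ) : 0 < bits c n := by
  rw [bits]
  omega

theorem bits_le_mul_log (c : ℕ) (hn : 2 ≤ n) : (bits c n : ℝ) ≤ 6 * (c + 1) * Real.log n := by
  have hlog₂ := Real.log_two_gt_d9
  have hlog : Real.log 2 ≤ Real.log n := Real.log_le_log two_pos (by exact_mod_cast hn)
  have hnat : (Nat.log 2 n : ℝ) * Real.log 2 ≤ Real.log n :=
    (le_div_iff₀ (by linarith)).1 (Real.natLog_le_logb n 2)
  have hsucc : (Nat.log 2 n : ℝ) + 1 ≤ 3 * Real.log n := by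
    nlinarith [(Nat.log 2 n).cast_nonneg (α := ℝ)]
  calc (bits c n : ℝ) = 2 * c * (Nat.log 2 n + 1) + 2 := by
        rw [bits]
        push_cast
        ring
    _ ≤ 2 * c * (3 * Real.log n) + 2 * (3 * Real.log n) := by gcongr; linarith
    _ = 6 * (c + 1) * Real.log n := by ring

/-- The number of rounds in which an algorithm with groups of `2 * k` half-edges gathers
information. A single node has no edges to label. -/
def gatherRounds (k c n : ℕ) : ℕ := if n ≤ 1 then 0 else 400 * (k * bits c n) + 1

theorem gatherRounds_le (hε : 0 < ε) (c n : ℕ) :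
    (gatherRounds ⌈ε⁻¹⌉₊ c n : ℝ) ≤ 4812 * (c + 1) * (max ε⁻¹ 4 * Real.log n) := by
  have ha : (4 : ℝ) ≤ max ε⁻¹ 4 := le_max_right _ _
  by_cases hn : n ≤ 1
  · rw [gatherRounds, if_pos hn, Nat.cast_zero]
    positivity
  have hk : (⌈ε⁻¹⌉₊ : ℝ) ≤ 2 * max ε⁻¹ 4 := by
    linarith [Nat.ceil_lt_add_one (inv_pos.2 hε).le, le_max_left ε⁻¹ 4]
  have hone : (1 : ℝ) ≤ ⌈ε⁻¹⌉₊ * bits c n := by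
    exact_mod_cast Nat.mul_pos (Nat.ceil_pos.2 (inv_pos.2 hε)) (bits_pos c n)
  calc (gatherRounds ⌈ε⁻¹⌉₊ c n : ℝ) = 400 * (⌈ε⁻¹⌉₊ * bits c n) + 1 := by
        rw [gatherRounds, if_neg hn]
        push_cast
        rfl
    _ ≤ 401 * (⌈ε⁻¹⌉₊ * bits c n) := by linarith
    _ ≤ 401 * ((2 * max ε⁻¹ 4) * (6 * (c + 1) * Real.log n)) := by
        gcongr
        exact bits_le_mul_log c (by omega)
    _ = 4812 * (c + 1) * (max ε⁻¹ 4 * Real.log n) := by ring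

/-- A lower bound on the factors of `splittingTime` other than `max ε⁻¹ 4` and `log n`. -/
noncomputable def slack : ℝ := Real.log (Real.log 4) ^ (1.71 : ℝ)

theorem one_lt_log_four : 1 < Real.log 4 :=
  (Real.lt_log_iff_exp_lt (by norm_num)).2 (Real.exp_one_lt_three.trans (by norm_num))

theorem slack_pos : 0 < slack := Real.rpow_pos_of_pos (Real.log_pos one_lt_log_four) _

theorem slack_mul_le_splittingTime (ε : ℝ) (n : ℕ) :
    slack * (max ε⁻¹ 4 * Real.log n) ≤ splittingTime ε n := by
  set a := max ε⁻¹ 4 with ha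
  have hlog₄ := one_lt_log_four
  have hlog : Real.log 4 ≤ Real.log a := Real.log_le_log (by norm_num) (le_max_right _ _)
  have hslack : slack ≤ Real.log (Real.log a) ^ (1.71 : ℝ) :=
    Real.rpow_le_rpow (Real.log_pos hlog₄).le (Real.log_le_log (by linarith) hlog) (by norm_num)
  have hn : 0 ≤ a * Real.log n :=
    mul_nonneg (zero_le_four.trans (le_max_right _ _)) (Real.log_natCast_nonneg n)
  calc slack * (a * Real.log n) ≤ Real.log (Real.log a) ^ (1.71 : ℝ) * (a * Real.log n) := by
        gcongr
    _ ≤ Real.log a * (Real.log (Real.log a) ^ (1.71 : ℝ) * (a * Real.log n)) :=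
        le_mul_of_one_le_left (mul_nonneg (slack_pos.le.trans hslack) hn) (by linarith)
    _ = splittingTime ε n := by rw [splittingTime, ← ha]; ring

theorem mul_le_div_slack_mul_splittingTime {C : ℝ} (hC : 0 ≤ C) (ε : ℝ) (n : ℕ) :
    C * (max ε⁻¹ 4 * Real.log n) ≤ C / slack * splittingTime ε n := by
  rw [div_mul_eq_mul_div, le_div_iff₀' slack_pos, mul_left_comm]
  exact mul_le_mul_of_nonneg_left (slack_mul_le_splittingTime ε n) hC

theorem two_mul_div_le_mul (hε : 0 < ε) (d : ℕ) :
    (2 : ℝ) * (d / (2 * ⌈ε⁻¹⌉₊) : ℕ) ≤ ε * d := by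
  have hk : 0 < (⌈ε⁻¹⌉₊ : ℝ) := Nat.cast_pos.2 (Nat.ceil_pos.2 (inv_pos.2 hε))
  have hinv : (⌈ε⁻¹⌉₊ : ℝ)⁻¹ ≤ ε := inv_le_of_inv_le₀ hε (Nat.le_ceil _)
  calc (2 : ℝ) * (d / (2 * ⌈ε⁻¹⌉₊) : ℕ) ≤ 2 * (d / (2 * ⌈ε⁻¹⌉₊)) := by
        gcongr
        exact_mod_cast Nat.cast_div_le (α := ℝ)
    _ = (⌈ε⁻¹⌉₊ : ℝ)⁻¹ * d := by field_simp [hk.ne']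
    _ ≤ ε * d := by gcongr

theorem IsBalanced.abs_cast_sum_le {α : Type*} {f : α → ℤ} {S : Finset α}
    (H : IsBalanced f S (S.card / (2 * ⌈ε⁻¹⌉₊))) (hε : 0 < ε) :
    |((∑ x ∈ S, f x : ℤ) : ℝ)| ≤ ε * S.card + 2 ∧
      (Odd S.card → |((∑ x ∈ S, f x : ℤ) : ℝ)| ≤ ε * S.card + 1) := by
  have hdiv := two_mul_div_le_mul hε S.card
  generalize S.card / (2 * ⌈ε⁻¹⌉₊) = q at H hdiv
  obtain ⟨heven, hodd⟩ := H
  constructor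
  · have := (Int.cast_le (R := ℝ)).2 heven
    push_cast at this ⊢
    linarith
  · intro h
    have := (Int.cast_le (R := ℝ)).2 (hodd h)
    push_cast at this ⊢
    linarith

end Parameters

section Networks

variable {V : Type*} [Fintype V] {G : SimpleGraph V} [DecidableRel G.Adj] {κ : Type*}
  {side : HalfEdge → κ} {k c : ℕ} {N : Network G} {v w : V}

/-- The edge `vw` of a network is directed from `v` to `w`. -/
def networkSplitting (side : HalfEdge → κ) (k c : ℕ) (N : Network G) (v w : V) : Prop :=
  Splitting (groups side k (halfEdges N)) (4 * k) (bits c (Fintype.card V)) (N.ident v, N.ident w)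

theorem isBounded_network (side : HalfEdge → κ) (hk : 0 < k)
    (hN : ∀ v, N.ident v ≤ Fintype.card V ^ c) :
    IsBounded (groups side k (halfEdges N)) (4 * k) (bits c (Fintype.card V)) := by
  refine isBounded_groups hk (finite_halfEdges N) ?_ ?_ ?_
  · rintro h ⟨v, w, hvw, rfl⟩
    exact ⟨w, v, hvw.symm, rfl⟩
  · rintro h ⟨v, w, hvw, rfl⟩ H
    exact hvw.ne (N.ident_injective (Prod.mk.inj H).2)
  · rintro h ⟨v, w, -, rfl⟩
    exact code_lt_two_pow_bits (hN v) (hN w)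

theorem networkSplitting_swap (hk : 0 < k) (hN : ∀ v, N.ident v ≤ Fintype.card V ^ c)
    (hvw : G.Adj v w) : networkSplitting side k c N w v ↔ ¬ networkSplitting side k c N v w :=
  (isBounded_network side hk hN).splitting_swap (groups_self_iff.2 ((mk_mem_halfEdges N).2 hvw))

theorem isBalanced_networkSplitting (hk : 0 < k) (hN : ∀ v, N.ident v ≤ Fintype.card V ^ c)
    {b : κ} {s : Finset V} (hs : ∀ w, w ∈ s ↔ G.Adj v w ∧ side (N.ident v, N.ident w) = b) :
    IsBalanced (sign (networkSplitting side k c N v)) s (s.card / (2 * k)) := by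
  set i : V ↪ HalfEdge := ⟨fun w => (N.ident v, N.ident w), fun _ _ H =>
    N.ident_injective (Prod.mk.inj H).2⟩ with hi
  have hS : ∀ h, h ∈ s.map i ↔ h ∈ halfEdges N ∧ h.1 = N.ident v ∧ side h = b := by
    intro h
    rw [Finset.mem_map]
    constructor
    · rintro ⟨w, hw, rfl⟩
      exact ⟨(mk_mem_halfEdges N).2 ((hs w).1 hw).1, rfl, ((hs w).1 hw).2⟩
    · rintro ⟨⟨v', w, hvw, rfl⟩, hv, hb⟩
      obtain rfl := N.ident_injective hv
      exact ⟨w, (hs w).2 ⟨hvw, hb⟩, rfl⟩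
  have H := isBalanced_side hk
    (fun h T hT => (isBounded_network side hk hN).isBalanced_splitting hT) hS
  rw [IsBalanced, Finset.sum_map, Finset.card_map] at H
  exact H

/-- The algorithm that labels the edges according to the splitting of the network. -/
def splittingAlgorithm {Out : Type} (side : HalfEdge → κ) (k c : ℕ) (φ : HalfEdge → Prop → Out) :
    LocalAlgorithm Out :=
  flooding (gatherRounds k c) fun n D h => φ h (Splitting (groups side k D) (4 * k) (bits c n) h)

theorem splittingAlgorithm_label {Out : Type} (side : HalfEdge → κ) (hk : 0 < k) (c : ℕ)
    (φ : HalfEdge → Prop → Out) (N : Network G) (hvw : G.Adj v w) :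
    (splittingAlgorithm side k c φ).label N hvw =
      φ (N.ident v, N.ident w) (networkSplitting side k c N v w) := by
  have hn : ¬ Fintype.card V ≤ 1 := fun H => hvw.ne (Fintype.card_le_one_iff.1 H v w)
  have hT : gatherRounds k c (Fintype.card V) =
      400 * (k * bits c (Fintype.card V)) + 1 := if_neg hn
  have hb := bits_pos c (Fintype.card V)
  have hkb : k ≤ k * bits c (Fintype.card V) := Nat.le_mul_of_pos_right k hb
  have hbk : bits c (Fintype.card V) ≤ k * bits c (Fintype.card V) := Nat.le_mul_of_pos_left _ hk
  rw [splittingAlgorithm, flooding_label N hvw (by omega)]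
  congr 1
  refine propext (Agree.splitting_iff (r := 400 * (k * bits c (Fintype.card V)))
    (agree_known N side k hvw (by omega)) ?_).symm
  rw [flowRadius, cutRadius]
  ring_nf at hkb hbk ⊢
  omega

end Networks

section Sign

variable {V : Type*} {P : V → Prop} {s : Finset V}

theorem sum_sign [DecidablePred P] :
    ∑ x ∈ s, sign P x = ((s.filter P).card : ℤ) - (s.filter fun x => ¬ P x).card := by
  have hsign : ∀ x, sign P x = (if P x then 1 else 0) - if ¬ P x then 1 else 0 := fun x => by
    by_cases h : P x <;> simp [sign, h]
  simp only [hsign, Finset.sum_sub_distrib, Finset.sum_boole]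

end Sign

section Directed

variable {V : Type*} {G : SimpleGraph V} {P : V → V → Prop}

/-- The digraph that directs the edges `vw` of `G` with `P v w` from `v` to `w`. -/
def orient (G : SimpleGraph V) (P : V → V → Prop) : Digraph V := ⟨fun v w => G.Adj v w ∧ P v w⟩

theorem orient_adj_swap (hP : ∀ ⦃v w⦄, G.Adj v w → (P w v ↔ ¬ P v w)) {v w : V} :
    (orient G P).Adj w v ↔ G.Adj v w ∧ ¬ P v w :=
  ⟨fun H => ⟨H.1.symm, (hP H.1.symm).1 H.2⟩, fun H => ⟨H.1.symm, (hP H.1).2 H.2⟩⟩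

theorem isOrientation_orient (hP : ∀ ⦃v w⦄, G.Adj v w → (P w v ↔ ¬ P v w)) :
    IsOrientation G (orient G P) := by
  refine ⟨fun _ _ H => H.1, fun v w hvw => ?_⟩
  rw [orient_adj_swap hP (v := v)]
  by_cases h : P v w
  · exact Or.inl ⟨⟨hvw, h⟩, fun H => H.2 h⟩
  · exact Or.inr ⟨⟨hvw, h⟩, fun H => h H.2⟩

theorem directedDiscrepancy_orient [Fintype V] [DecidableRel G.Adj]
    (hP : ∀ ⦃v w⦄, G.Adj v w → (P w v ↔ ¬ P v w)) (v : V) :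
    directedDiscrepancy (orient G P) v =
      |((∑ w ∈ G.neighborFinset v, sign (P v) w : ℤ) : ℝ)| := by
  classical
  have hout : {w | (orient G P).Adj v w} = ((G.neighborFinset v).filter (P v) : Finset V) := by
    ext w
    simp [orient]
  have hin : {w | (orient G P).Adj w v} =
      ((G.neighborFinset v).filter fun w => ¬ P v w : Finset V) := by
    ext w
    simp [orient_adj_swap hP]
  rw [directedDiscrepancy, hout, hin, Set.ncard_coe_finset, Set.ncard_coe_finset, sum_sign]
  push_cast
  rfl

end Directed

section Undirected

variable {V : Type*} {ι : V → ℕ} {P : V → V → Prop} {v w : V}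

/-- The coloring in which an edge is red if `P` holds from its end of smaller `ι` to the other. -/
noncomputable def color (ι : V → ℕ) (P : V → V → Prop) (e : Sym2 V) : ℤˣ :=
  open Classical in if ∃ v w, e = s(v, w) ∧ ι v < ι w ∧ P v w then 1 else -1

open Classical in
theorem color_mk (hι : ι v ≠ ι w) (hP : P w v ↔ ¬ P v w) :
    color ι P s(v, w) = if P v w ↔ ι v < ι w then 1 else -1 := by
  have hiff : (∃ v' w', s(v, w) = s(v', w') ∧ ι v' < ι w' ∧ P v' w') ↔ (P v w ↔ ι v < ι w) := by
    constructor
    · rintro ⟨v', w', he, hlt, h⟩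
      rcases Sym2.eq_iff.1 he with ⟨rfl, rfl⟩ | ⟨rfl, rfl⟩
      · exact iff_of_true h hlt
      · exact iff_of_false (hP.1 h) hlt.asymm
    · intro H
      rcases lt_or_gt_of_ne hι with hlt | hlt
      · exact ⟨v, w, rfl, hlt, H.2 hlt⟩
      · exact ⟨w, v, Sym2.eq_swap, hlt, hP.2 fun h => hlt.asymm (H.1 h)⟩
  simp only [color, hiff]

theorem coe_color_mk (hι : ι v ≠ ι w) (hP : P w v ↔ ¬ P v w) :
    (color ι P s(v, w) : ℤ) = if ι v < ι w then sign (P v) w else -sign (P v) w := by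
  rw [color_mk hι hP, sign]
  by_cases h : P v w <;> by_cases hlt : ι v < ι w <;> simp [h, hlt]

variable [Fintype V] {G : SimpleGraph V} [DecidableRel G.Adj]

theorem incidenceFinset_eq_image [DecidableEq V] (v : V) :
    G.incidenceFinset v = (G.neighborFinset v).image fun w => s(v, w) := by
  ext e
  simp only [SimpleGraph.mem_incidenceFinset, Finset.mem_image, SimpleGraph.mem_neighborFinset]
  constructor
  · rintro ⟨he, w, rfl⟩
    exact ⟨w, he, rfl⟩
  · rintro ⟨w, hw, rfl⟩
    exact ⟨hw, Sym2.mem_mk_left v w⟩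

theorem undirectedDiscrepancy_color [DecidableEq V] (hι : Function.Injective ι)
    (hP : ∀ ⦃v w⦄, G.Adj v w → (P w v ↔ ¬ P v w)) (v : V) :
    undirectedDiscrepancy G (color ι P) v =
      |((∑ w ∈ G.neighborFinset v with ι v < ι w, sign (P v) w : ℤ) : ℝ) -
        ((∑ w ∈ G.neighborFinset v with ¬ ι v < ι w, sign (P v) w : ℤ) : ℝ)| := by
  have hcolor : ∀ w ∈ G.neighborFinset v, (color ι P s(v, w) : ℤ) =
      if ι v < ι w then sign (P v) w else -sign (P v) w := fun w hw => by
    rw [SimpleGraph.mem_neighborFinset] at hw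
    exact coe_color_mk (hι.ne hw.ne) (hP hw)
  rw [undirectedDiscrepancy, incidenceFinset_eq_image,
    Finset.sum_image fun x _ y _ H => Sym2.congr_right.1 H, ← Int.cast_sum,
    Finset.sum_congr rfl hcolor, Finset.sum_ite, Finset.sum_neg_distrib, ← sub_eq_add_neg,
    Int.cast_sub]

end Undirected

section Solutions

variable {ε : ℝ}

open Classical in
theorem solvesDirectedSplitting (c : ℕ) (hε : 0 < ε) :
    (splittingAlgorithm (fun _ => ()) ⌈ε⁻¹⌉₊ c fun _ p =>
      if p then EdgeDirection.outgoing else EdgeDirection.incoming).SolvesDirectedSplitting.{u}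
        c ε := by
  intro V _ G _ N hN
  have hk : 0 < ⌈ε⁻¹⌉₊ := Nat.ceil_pos.2 (inv_pos.2 hε)
  set P := networkSplitting (fun _ => ()) ⌈ε⁻¹⌉₊ c N with hP
  have hswap : ∀ ⦃v w⦄, G.Adj v w → (P w v ↔ ¬ P v w) := fun v w => networkSplitting_swap hk hN
  refine ⟨orient G P, isOrientation_orient hswap, fun v w hvw => ?_, fun v => ?_⟩
  · rw [splittingAlgorithm_label _ hk, ← hP, orient_adj_swap hswap (v := v)]
    by_cases h : P v w <;> simp [orient, h, hvw]
  · have hbal := (isBalanced_networkSplitting hk hN (side := fun _ => ()) (v := v) (b := ())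
      (s := G.neighborFinset v) (by simp)).abs_cast_sum_le hε
    rw [G.card_neighborFinset_eq_degree, ← directedDiscrepancy_orient hswap] at hbal
    exact ⟨hbal.2, fun _ => hbal.1⟩

open Classical in
theorem solvesUndirectedSplitting (c : ℕ) (hε : 0 < ε) :
    (splittingAlgorithm (fun h => h.1 < h.2) ⌈ε⁻¹⌉₊ c fun h p =>
      if p ↔ h.1 < h.2 then (1 : ℤˣ) else -1).SolvesUndirectedSplitting.{u} c ε := by
  intro V _ _ G _ N hN
  have hk : 0 < ⌈ε⁻¹⌉₊ := Nat.ceil_pos.2 (inv_pos.2 hε)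
  set P := networkSplitting (fun h => h.1 < h.2) ⌈ε⁻¹⌉₊ c N
  have hswap : ∀ ⦃v w⦄, G.Adj v w → (P w v ↔ ¬ P v w) := fun v w => networkSplitting_swap hk hN
  refine ⟨color N.ident P, fun v w hvw => ?_, fun v => ?_⟩
  · rw [splittingAlgorithm_label _ hk, color_mk (N.ident_injective.ne hvw.ne) (hswap hvw)]
  · set A := (G.neighborFinset v).filter fun w => N.ident v < N.ident w with hA
    set B := (G.neighborFinset v).filter fun w => ¬ N.ident v < N.ident w with hB
    have hbalA := ((isBalanced_networkSplitting hk hN (side := fun h => h.1 < h.2) (v := v)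
      (b := True) (s := A) (by simp [hA])).abs_cast_sum_le hε).1
    have hbalB := ((isBalanced_networkSplitting hk hN (side := fun h => h.1 < h.2) (v := v)
      (b := False) (s := B) (by simp [hB])).abs_cast_sum_le hε).1
    have hcard : (A.card : ℝ) + B.card = G.degree v := by
      rw [← G.card_neighborFinset_eq_degree]
      exact_mod_cast Finset.card_filter_add_card_filter_not (fun w => N.ident v < N.ident w)
    rw [undirectedDiscrepancy_color N.ident_injective hswap, ← hcard]
    refine (abs_sub _ _).trans ?_
    linarith

end Solutions

end DegreeSplitting

theorem theorem1_general :
    ∀ c : ℕ, ∃ C : ℝ, 0 < C ∧ ∀ ε : ℝ, 0 < ε →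
      (∃ A : LocalAlgorithm EdgeDirection,
        (∀ n : ℕ, (A.rounds n : ℝ) ≤ C * (max ε⁻¹ 4 * Real.log n)) ∧
        LocalAlgorithm.SolvesDirectedSplitting.{u} A c ε) ∧
      (∃ A : LocalAlgorithm ℤˣ,
        (∀ n : ℕ, (A.rounds n : ℝ) ≤ C * (max ε⁻¹ 4 * Real.log n)) ∧
        LocalAlgorithm.SolvesUndirectedSplitting.{u} A c ε) :=
  fun c => ⟨4812 * (c + 1), by positivity, fun _ hε =>
    ⟨⟨_, DegreeSplitting.gatherRounds_le hε c, DegreeSplitting.solvesDirectedSplitting c hε⟩,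
      ⟨_, DegreeSplitting.gatherRounds_le hε c, DegreeSplitting.solvesUndirectedSplitting c hε⟩⟩⟩

theorem theorem1 :
    ∀ c : ℕ, ∃ C : ℝ, 0 < C ∧ ∀ ε : ℝ, 0 < ε →
      (∃ A : LocalAlgorithm EdgeDirection,
        (∀ n : ℕ, (A.rounds n : ℝ) ≤ C * splittingTime ε n) ∧
        LocalAlgorithm.SolvesDirectedSplitting.{u} A c ε) ∧
      (∃ A : LocalAlgorithm ℤˣ,
        (∀ n : ℕ, (A.rounds n : ℝ) ≤ C * splittingTime ε n) ∧
        LocalAlgorithm.SolvesUndirectedSplitting.{u} A c ε) := by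
  intro c
  obtain ⟨C, hC, H⟩ := theorem1_general.{u} c
  have hle := DegreeSplitting.mul_le_div_slack_mul_splittingTime hC.le
  exact ⟨C / DegreeSplitting.slack, div_pos hC DegreeSplitting.slack_pos, fun ε hε =>
    (H ε hε).imp (fun ⟨A, hA, hS⟩ => ⟨A, fun n => (hA n).trans (hle ε n), hS⟩)
      fun ⟨A, hA, hS⟩ => ⟨A, fun n => (hA n).trans (hle ε n), hS⟩⟩
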